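/- Let $n\ge 1$ be divisible by $6$. For $J=(J_k)_{k\in\mathbb Z_n}\in\{1,-1\}^n$ let $H(J)=\sum_{k\in\mathbb Z_n}J_kZ_kZ_{k+1}$ be the Ising Hamiltonian on $n$ qubits placed on the cycle graph with vertex set $\mathbb Z_n$, and let $E_{\max}(J)=\max_x\langle x|H(J)|x\rangle$, the maximum being over computational basis states (bit strings $x\in\{0,1\}^n$, equivalently spin configurations in $\{1,-1\}^n$). The approximation ratio of an output $x$ is $\langle x|H(J)|x\rangle/E_{\max}(J)$. Definitions. (a) *Level-$p$ QAOA.* For a diagonal Hamiltonian $H$ on a finite set of qubits and $\beta,\gamma\in\mathbb R^p$ let $|\Psi_H(\beta,\gamma)\rangle=\prod_{m=1}^p\bigl(e^{i\beta_mB}e^{i\gamma_mH}\bigr)|+\cdots+\rangle$ with $B=\sum_jX_j$. The approximation ratio achieved by level-$p$ QAOA on $H(J)$ is $\max_{\beta,\gamma\in\mathbb R^p}\langle\Psi_{H(J)}(\beta,\gamma)|H(J)|\Psi_{H(J)}(\beta,\gamma)\rangle/E_{\max}(J)$. (b) *Uniform local algorithms.* For a vertex $v$ of a graph, $E_r(v)$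 is the set of edges that belong to a path of length at most $r$ starting at $v$. A deterministic algorithm that maps real edge weights $(J_e)_e$ to spins (or bits) $(x_v)_v$ is $r$-local if, for every input, each $x_v$ is a function $g_v$ of $(J_e)_{e\in E_r(v)}$ only. On the cycle graph it is uniform if all $g_v$ coincide after $E_r(v)$ is identified with $E_r(0)$ by the translation $w\mapsto v+w$. The instance $J$ gives the edge $\{k,k+1\}$ the weight $J_k$. (c) *Level-$p$ RQAOA* with threshold $n_c$. The input is a hypergraph $(V,E)$ with real weights $J_e$ and cost Hamiltonian $H=\sum_{e\in E}J_e\prod_{v\in e}Z_v$ (for $H(J)$, the cycle graph with edges $\{k,k+1\}$ and weights $J_k$). While more than $n_c$ variables are left: take angles $(\beta,\gamma)$ that maximize the expected energy of $H$ in $\Psi=\Psi_H(\beta,\gamma)$; compute $M_e=\langle\Psi|\prod_{v\in e}Z_v|\Psi\rangle$; choose a non-empty hyperedge $f\in E$ with $|M_f|$ maximal among the non-empty hyperedges, and a vertex $v\in f$; impose the constraint $\prod_{w\in f}x_w=\operatorname{sign}(M_f)$ and use it to eliminate $x_v$. That is, every $e\in E$ with $v\in e$ is replaced by $e\triangle f$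 with weight $\operatorname{sign}(M_f)J_e$; weights of hyperedges that become equal are added; the empty hyperedge is a constant. The problem with $n_c$ variables is then solved exactly by exhaustive search, and the values of the eliminated variables are recovered from the constraints. All ties and free choices are resolved arbitrarily. **Theorem.** For every such $n$ there is a set $\mathcal S\subset\{1,-1\}^n$ of $2^{n/3}$ instances with the following properties. (i) There is a single $1$-local uniform classical algorithm which achieves the approximation ratio $1$ on $H(J)$ for every $J\in\mathcal S$. (ii) For every $J\in\mathcal S$ and every level $p$ with $2p<n$, the approximation ratio achieved by level-$p$ QAOA on $H(J)$ (where the maximum over $\beta,\gamma$ is attained) is at most $p/(p+1)$. (iii) For every $J\in\mathcal S$ and every threshold $1\le n_c\le n$, level-$1$ RQAOA on $H(J)$ can be run to completion, and every possible output (whatever choice of optimal angles, ties and eliminated vertices) has approximation ratio $1$. -/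

import Mathlib

/-!
Qubits are indexed by a finite type `V`.  The computational basis is labelled by the spin
configurations `x : V → ℤˣ`, where `ℤˣ = {1, -1}`; a bit `b` corresponds to the spin `(-1) ^ b`.
-/

noncomputable section

namespace QAOA

section Operators

variable {V : Type*} [Fintype V] [DecidableEq V]

/-- Operators on the Hilbert space `(ℂ²)^{⊗ V}`, as matrices in the computational basis. -/
abbrev Op (V : Type*) : Type _ := Matrix (V → ℤˣ) (V → ℤˣ) ℂ

/-- The Pauli operator `Z_v`. -/
def pauliZ (v : V) : Op V := Matrix.diagonal fun x => ((x v : ℤ) : ℂ)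

/-- The Pauli operator `X_v`, which flips the spin `v`. -/
def pauliX (v : V) : Op V :=
  Matrix.of fun x y => if x = Function.update y v (-(y v)) then 1 else 0

/-- `Z(e) = ∏_{v ∈ e} Z_v`. -/
def zProd (e : Finset V) : Op V := Matrix.diagonal fun x => ∏ v ∈ e, ((x v : ℤ) : ℂ)

/-- The mixing operator `B = ∑_v X_v`. -/
def mixer (V : Type*) [Fintype V] [DecidableEq V] : Op V := ∑ v : V, pauliX v

/-- The product state `|+⟩^{⊗ V}`. -/
def plusState (V : Type*) [Fintype V] : (V → ℤˣ) → ℂ :=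
  fun _ => ((1 / Real.sqrt (2 ^ Fintype.card V) : ℝ) : ℂ)

/-- The level-`p` unitary `∏_{m=1}^p e^{i β_m B} e^{i γ_m H}`. -/
def qaoaUnitary {p : ℕ} (H : Op V) (β γ : Fin p → ℝ) : Op V :=
  (List.ofFn fun m : Fin p =>
    NormedSpace.exp ((Complex.I * (β m : ℂ)) • mixer V) *
      NormedSpace.exp ((Complex.I * (γ m : ℂ)) • H)).prod

/-- The level-`p` QAOA state `Ψ_H(β, γ)`. -/
def qaoaState {p : ℕ} (H : Op V) (β γ : Fin p → ℝ) : (V → ℤˣ) → ℂ :=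
  Matrix.mulVec (qaoaUnitary H β γ) (plusState V)

/-- The expected value `⟨ψ|A|ψ⟩` of a self-adjoint operator `A`. -/
def expect (A : Op V) (ψ : (V → ℤˣ) → ℂ) : ℝ := (star ψ ⬝ᵥ Matrix.mulVec A ψ).re

/-- The diagonal matrix element `⟨x|H|x⟩`. -/
def energy (H : Op V) (x : V → ℤˣ) : ℝ := (H x x).re

/-- `max_x ⟨x|H|x⟩`; the maximum is over the finite non-empty set of basis states. -/
def maxEnergy (H : Op V) : ℝ := ⨆ x : V → ℤˣ, energy H x

/-- The approximation ratio of a single output configuration. -/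
def approxRatio (H : Op V) (x : V → ℤˣ) : ℝ := energy H x / maxEnergy H

/-- `ρ = max_{β, γ ∈ ℝ^p} ⟨Ψ_H(β,γ)|H|Ψ_H(β,γ)⟩ / max_x ⟨x|H|x⟩`: the expected approximation
ratio achieved by level-`p` QAOA, including that the maximum over the angles is attained. -/
def IsQAOARatio (p : ℕ) (H : Op V) (ρ : ℝ) : Prop :=
  IsGreatest
    {t : ℝ | ∃ β γ : Fin p → ℝ, t = expect H (qaoaState H β γ) / maxEnergy H} ρ

/-- The angles `(β, γ)` maximize the expected energy of `H` in the level-`p` QAOA state. -/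
def IsOptimalAngles {p : ℕ} (H : Op V) (β γ : Fin p → ℝ) : Prop :=
  ∀ β' γ' : Fin p → ℝ, expect H (qaoaState H β' γ') ≤ expect H (qaoaState H β γ)

end Operators

section Recursive

/-- A hypergraph on the vertex set `V` with real hyperedge weights. The empty hyperedge is
allowed; it contributes a constant energy shift. -/
structure WeightedHypergraph (V : Type*) where
  /-- the set of hyperedges -/
  edges : Finset (Finset V)
  /-- the weights; only the values on `edges` matter -/
  weight : Finset V → ℝ

namespace WeightedHypergraph

variable {V : Type*} [Fintype V] [DecidableEq V]

/-- `H_G(J) = ∑_{e ∈ E} J_e Z(e)`. -/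
def hamiltonian (G : WeightedHypergraph V) : Op V :=
  ∑ e ∈ G.edges, (G.weight e : ℂ) • zProd e

/-- The hyperedge on `V \ {v}` that replaces `e` when `x_v` is eliminated by means of a
constraint on `x(f)`, where `v ∈ f`: it is `e` if `v ∉ e` and `e ∆ f` if `v ∈ e`. -/
def reduceEdge (f : Finset V) (v : V) (e : Finset V) : Finset {w : V // w ≠ v} :=
  (if v ∈ e then symmDiff e f else e).subtype (fun w => w ≠ v)

/-- Elimination of `x_v` by means of the constraint `x(f) = σ`, where `v ∈ f`. Weights of
hyperedges that become equal add up. -/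
def eliminate (G : WeightedHypergraph V) (f : Finset V) (v : V) (σ : ℤˣ) :
    WeightedHypergraph {w : V // w ≠ v} where
  edges := G.edges.image (reduceEdge f v)
  weight := fun e' =>
    ∑ e ∈ G.edges with reduceEdge f v e = e',
      (if v ∈ e then ((σ : ℤ) : ℝ) else 1) * G.weight e

/-- The map `ξ` which extends a configuration on `V \ {v}` to the configuration on `V` that
satisfies the constraint `x(f) = σ`. -/
def extend (f : Finset V) (v : V) (σ : ℤˣ) (y : {w : V // w ≠ v} → ℤˣ) : V → ℤˣ :=
  fun w => if h : w = v then σ * ∏ u ∈ f.subtype (fun w => w ≠ v), y u else y ⟨w, h⟩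

end WeightedHypergraph

/-- The sign of a real number as an element of `{1, -1}`. -/
def signUnit (t : ℝ) : ℤˣ := if t < 0 then -1 else 1

/-- `IsRQAOARun p k G x`: the configuration `x` is a possible output of the recursive algorithm
of level `p` on the input `G` with `k` variable eliminations. An elimination step takes optimal
level-`p` angles, a non-empty hyperedge `f` of largest `|M_f|` where `M_e = ⟨Ψ|Z(e)|Ψ⟩`, and a
vertex `v ∈ f`, and imposes `x(f) = sign(M_f)`; all ties are broken arbitrarily. After `k`
eliminations the remaining problem is solved by exhaustive search. -/
def IsRQAOARun (p : ℕ) :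
    ℕ → {V : Type} → [Fintype V] → [DecidableEq V] → WeightedHypergraph V → (V → ℤˣ) → Prop
  | 0, _, _, _, G, x => ∀ y, energy G.hamiltonian y ≤ energy G.hamiltonian x
  | k + 1, V, _, _, G, x =>
    ∃ β γ : Fin p → ℝ, IsOptimalAngles G.hamiltonian β γ ∧
      ∃ f ∈ G.edges, f.Nonempty ∧
        (∀ e ∈ G.edges, e.Nonempty →
          |expect (zProd e) (qaoaState G.hamiltonian β γ)| ≤
            |expect (zProd f) (qaoaState G.hamiltonian β γ)|) ∧
        ∃ v ∈ f, ∃ σ : ℤˣ, σ = signUnit (expect (zProd f) (qaoaState G.hamiltonian β γ)) ∧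
          ∃ y : {w : V // w ≠ v} → ℤˣ,
            IsRQAOARun p k (G.eliminate f v σ) y ∧ x = WeightedHypergraph.extend f v σ y

/-- `x` is a possible output of level-`p` RQAOA on `G` with threshold `nc`: variables are
eliminated until `nc` of them are left. -/
def IsRQAOAOutput (p nc : ℕ) {V : Type} [Fintype V] [DecidableEq V]
    (G : WeightedHypergraph V) (x : V → ℤˣ) : Prop :=
  IsRQAOARun p (Fintype.card V - nc) G x

end Recursive

section Local

variable {V : Type*}

/-- `E_r(v)`: the edges that belong to a path of length at most `r` starting at `v`. -/
def localEdges (G : SimpleGraph V) (r : ℕ) (v : V) : Set G.edgeSet :=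
  {e | ∃ (w : V) (q : G.Walk v w), q.IsPath ∧ q.length ≤ r ∧ (e : Sym2 V) ∈ q.edges}

/-- A (deterministic) classical algorithm, which maps edge weights to a spin configuration, is
`r`-local if the output at `v` is a function of the weights of the edges in `E_r(v)`. -/
def IsLocalAlgorithm (G : SimpleGraph V) (r : ℕ) (A : (G.edgeSet → ℝ) → V → ℤˣ) : Prop :=
  ∃ g : (v : V) → (localEdges G r v → ℝ) → ℤˣ,
    ∀ (J : G.edgeSet → ℝ) (v : V), A J v = g v (fun e => J e)

/-- An `r`-local algorithm is uniform, with respect to a base vertex `v₀` and automorphisms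
`π v` which map `v₀` to `v`, if the local functions at all vertices coincide after `E_r(v)` is
identified with `E_r(v₀)` by means of `π v`. -/
def IsUniformLocalAlgorithm (G : SimpleGraph V) (v₀ : V) (π : V → (G ≃g G)) (r : ℕ)
    (A : (G.edgeSet → ℝ) → V → ℤˣ) : Prop :=
  IsLocalAlgorithm G r A ∧ (∀ v, π v v₀ = v) ∧
    ∃ g : (localEdges G r v₀ → ℝ) → ℤˣ,
      ∀ (J : G.edgeSet → ℝ) (v : V),
        A J v = g (fun e => J ((π v).mapEdgeSet (e : G.edgeSet)))

end Local

section Ring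

/-- The cycle graph on `ℤ/n`: `u` and `v ≠ u` are adjacent iff `u - v = 1` or `v - u = 1`. -/
abbrev ringGraph (n : ℕ) : SimpleGraph (ZMod n) := SimpleGraph.circulantGraph {1}

/-- The translation `w ↦ v + w` as an automorphism of the cycle graph. -/
def ringTranslation (n : ℕ) (v : ZMod n) : ringGraph n ≃g ringGraph n where
  toEquiv := Equiv.addLeft v
  map_rel_iff' := by simp

variable {n : ℕ} [NeZero n]

/-- `H(J) = ∑_{k ∈ ℤ/n} J_k Z_k Z_{k+1}`. -/
def ringHamiltonian (J : ZMod n → ℤˣ) : Op (ZMod n) :=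
  ∑ k : ZMod n, ((J k : ℤ) : ℂ) • (pauliZ k * pauliZ (k + 1))

/-- The coupling coefficients as edge weights on the cycle graph: for `n ≥ 3` the weight of the
edge `{k, k+1}` is `J_k`. -/
def ringWeights (J : ZMod n → ℤˣ) : (ringGraph n).edgeSet → ℝ :=
  fun e => ∑ k : ZMod n, if (e : Sym2 (ZMod n)) = s(k, k + 1) then ((J k : ℤ) : ℝ) else 0

/-- The weighted cycle graph as an input of RQAOA: for `n ≥ 3` the edges are `{k, k+1}`, with
weights `J_k`. -/
def ringInstance (J : ZMod n → ℤˣ) : WeightedHypergraph (ZMod n) where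
  edges := Finset.univ.image fun k : ZMod n => {k, k + 1}
  weight := fun e => ∑ k : ZMod n, if e = {k, k + 1} then ((J k : ℤ) : ℝ) else 0

/-- The cost Hamiltonian of `ringInstance J` is `ringHamiltonian J`. -/
theorem ringInstance_hamiltonian (hn : 2 ≤ n) (J : ZMod n → ℤˣ) :
    (ringInstance J).hamiltonian = ringHamiltonian J := by
  have hne : ∀ k : ZMod n, k ≠ k + 1 := by
    intro k h
    have : Fact (1 < n) := ⟨hn⟩
    exact one_ne_zero (left_eq_add.mp h)
  have hz : ∀ k : ZMod n, zProd {k, k + 1} = pauliZ k * pauliZ (k + 1) := by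
    intro k
    simp [zProd, pauliZ, Matrix.diagonal_mul_diagonal, Finset.prod_pair (hne k)]
  simp only [WeightedHypergraph.hamiltonian, ringInstance, ringHamiltonian, ← hz]
  simp only [Complex.ofReal_sum, Finset.sum_smul]
  rw [Finset.sum_comm]
  refine Finset.sum_congr rfl fun k _ => ?_
  rw [Finset.sum_eq_single ({k, k + 1} : Finset (ZMod n))]
  · simp
  · intro e _ he
    simp [he]
  · intro h
    exact absurd (Finset.mem_image_of_mem _ (Finset.mem_univ k)) h

end Ring

end QAOA

end

/-! The instances are gauge copies of the ferromagnetic ring: a configuration `x` equal to `1` off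
the multiples of 3 gives the couplings `J k = x k * x (k + 1)`. All bonds can be satisfied at once,
so the maximal energy is `n` and every maximizer is `x` up to a global flip.

Local algorithm: a spin `-1` of `x` is isolated, so both of its bonds are negative, and no other
site has two negative bonds. One look at the adjacent weights recovers `x`.

QAOA: in the Heisenberg picture a bond observable spreads by one site per level and side. At level
`p` its signed expectation is therefore that of the central bond of an open chain on `2p + 2` sites,
where all couplings are gauged to `1` (`expect_ring_bond`). This number, `centralBond β γ`, depends
on neither `J` nor `n`. Evaluated on the ring of exactly `2p + 2` sites with one negative coupling,
where frustration caps the energy at `2p`, it satisfies `(2p + 2) * centralBond ≤ 2p`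
(`centralBond_le`). The maximum over angles is attained because integer spectra make the energy
`2π`-periodic in each angle.

RQAOA: the recursion preserves the class `IsSignedCycle` of cycles with couplings `s v * s (c v)`,
up to a constant. Rotation combined with a gauge change is a symmetry, so all bonds have the same
signed correlation. Level 1 strictly beats the uniform superposition for a nonconstant Hamiltonian
(`exists_expect_plusState_lt`), so this common value is positive at optimal angles. Every imposed
constraint then holds for `±s` (`IsSignedCycle.signUnit_expect_bond`), elimination yields the signed
cycle of the restricted `s` (`IsSignedCycle.eliminate`), and back-substitution returns `±s`
(`extend_eq`). -/

noncomputable section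

namespace QAOA

/-! ### Matrix exponentials and conjugation -/

section MatrixExponential

variable {m n : Type*} [Fintype m] [DecidableEq m] [Fintype n] [DecidableEq n]

open scoped Matrix.Norms.Operator in
theorem continuous_matrixExp :
    Continuous (NormedSpace.exp : Matrix m m ℂ → Matrix m m ℂ) :=
  NormedSpace.exp_continuous

-- A linear map between finite-dimensional spaces is continuous, so it passes through the
-- exponential series. Needed to move `lift` inside the QAOA evolution.
open scoped Matrix.Norms.Operator in
theorem algHom_matrixExp (f : Matrix m m ℂ →ₐ[ℂ] Matrix n n ℂ) (A : Matrix m m ℂ) :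
    f (NormedSpace.exp A) = NormedSpace.exp (f A) :=
  NormedSpace.map_exp f f.toLinearMap.continuous_of_finiteDimensional A

open scoped Matrix.Norms.Operator in
theorem hasDerivAt_matrixExp_smul (A : Matrix m m ℂ) (t : ℝ) :
    HasDerivAt (fun u : ℝ => NormedSpace.exp (u • A)) (NormedSpace.exp (t • A) * A) t :=
  hasDerivAt_exp_smul_const A t

/-- Summands of the generator that commute with everything drop out of a conjugation. -/
theorem exp_conj_add {A C D : Matrix m m ℂ} (hCD : Commute C D) (hAD : Commute A D) :
    NormedSpace.exp (-(C + D)) * A * NormedSpace.exp (C + D) =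
      NormedSpace.exp (-C) * A * NormedSpace.exp C := by
  have h1 : NormedSpace.exp (C + D) = NormedSpace.exp D * NormedSpace.exp C := by
    rw [add_comm, Matrix.exp_add_of_commute _ _ hCD.symm]
  have h2 : NormedSpace.exp (-(C + D)) = NormedSpace.exp (-C) * NormedSpace.exp (-D) := by
    rw [neg_add, Matrix.exp_add_of_commute _ _ (hCD.neg_left.neg_right)]
  have h3 : NormedSpace.exp (-D) * NormedSpace.exp D = 1 := by
    rw [← Matrix.exp_add_of_commute _ _ ((Commute.refl D).neg_left)]; simp
  have h4 : A * NormedSpace.exp D = NormedSpace.exp D * A := hAD.exp_right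
  calc _ = NormedSpace.exp (-C) * NormedSpace.exp (-D) * (A * NormedSpace.exp D) *
        NormedSpace.exp C := by rw [h1, h2]; noncomm_ring
    _ = NormedSpace.exp (-C) * (NormedSpace.exp (-D) * NormedSpace.exp D) * A *
        NormedSpace.exp C := by rw [h4]; noncomm_ring
    _ = _ := by rw [h3, mul_one]

theorem commute_exp_conj {A C K : Matrix m m ℂ} (hC : Commute C K) (hA : Commute A K) :
    Commute (NormedSpace.exp (-C) * A * NormedSpace.exp C) K :=
  ((hC.neg_left.exp_left).mul_left hA).mul_left hC.exp_left

end MatrixExponential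

/-! ### Algebra of Pauli operators -/

section Pauli

variable {V : Type*} [Fintype V] [DecidableEq V]

theorem pauliX_mul_pauliX_comm (v w : V) : Commute (pauliX v : Op V) (pauliX w) := by
  have key : ∀ v w : V, ∀ x y : V → ℤˣ, (pauliX v * pauliX w : Op V) x y =
      if x = Function.update (Function.update y w (-(y w))) v
        (-(Function.update y w (-(y w)) v)) then 1 else 0 := by
    intro v w x y
    simp only [Matrix.mul_apply, pauliX, Matrix.of_apply]
    rw [Finset.sum_eq_single (Function.update y w (-(y w)))]
    · simp
    · intro z _ hz; simp [hz]
    · simp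
  show _ = _
  ext x y
  rw [key, key]
  congr 2
  by_cases h : v = w
  · subst h; rfl
  · rw [Function.update_of_ne h, Function.update_of_ne (Ne.symm h), Function.update_comm h]

theorem pauliX_sq (v : V) : (pauliX v * pauliX v : Op V) = 1 := by
  ext x y
  simp only [Matrix.mul_apply, pauliX, Matrix.of_apply]
  rw [Finset.sum_eq_single (Function.update y v (-(y v)))]
  · simp [Matrix.one_apply]
  · intro z _ hz; simp [hz]
  · simp

theorem pauliX_isHermitian (v : V) : (pauliX v : Op V).IsHermitian := by
  ext x y
  simp only [Matrix.conjTranspose_apply, pauliX, Matrix.of_apply]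
  have : (y = Function.update x v (-(x v))) ↔ (x = Function.update y v (-(y v))) := by
    constructor <;> (rintro rfl; simp)
  by_cases h : x = Function.update y v (-(y v))
  · rw [if_pos h, if_pos (this.2 h)]; simp
  · rw [if_neg h, if_neg (fun h' => h (this.1 h'))]; simp

theorem mixer_isHermitian : (mixer V).IsHermitian := by
  unfold Matrix.IsHermitian mixer
  rw [Matrix.conjTranspose_sum]
  exact Finset.sum_congr rfl fun v _ => pauliX_isHermitian v

theorem pauliX_mul_apply (v : V) (A : Op V) (x y : V → ℤˣ) :
    (pauliX v * A) x y = A (Function.update x v (-(x v))) y := by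
  simp only [Matrix.mul_apply, pauliX, Matrix.of_apply]
  rw [Finset.sum_eq_single (Function.update x v (-(x v)))]
  · simp
  · intro z _ hz
    rw [if_neg, zero_mul]
    rintro rfl
    simp at hz
  · simp

theorem mul_pauliX_apply (v : V) (A : Op V) (x y : V → ℤˣ) :
    (A * pauliX v) x y = A x (Function.update y v (-(y v))) := by
  simp only [Matrix.mul_apply, pauliX, Matrix.of_apply]
  rw [Finset.sum_eq_single (Function.update y v (-(y v)))]
  · simp
  · intro z _ hz; simp [hz]
  · simp

theorem commute_diagonal {ι : Type*} [Fintype ι] [DecidableEq ι] (a b : ι → ℂ) :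
    Commute (Matrix.diagonal a) (Matrix.diagonal b) := by
  show _ = _
  rw [Matrix.diagonal_mul_diagonal, Matrix.diagonal_mul_diagonal]
  simp only [mul_comm]

theorem commute_pauliX_pauliZ {v w : V} (h : v ≠ w) :
    Commute (pauliX v : Op V) (pauliZ w) := by
  show _ = _
  ext x y
  rw [pauliX_mul_apply, mul_pauliX_apply]
  simp only [pauliZ, Matrix.diagonal_apply]
  have : (Function.update x v (-(x v)) = y) ↔ (x = Function.update y v (-(y v))) := by
    constructor <;> (rintro rfl; simp)
  by_cases h' : x = Function.update y v (-(y v))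
  · rw [if_pos h', if_pos (this.2 h'), Function.update_of_ne h.symm]
  · rw [if_neg h', if_neg (fun h'' => h' (this.1 h''))]

end Pauli

/-! ### Embedding operators along an injection of qubits with a gauge change -/

section Lift

variable {V W : Type*} [Fintype V] [DecidableEq V] [Fintype W] [DecidableEq W]

/-- The configuration on `W` seen by an injection `φ : W → V` with a sign change `t`. -/
def pullConfig (φ : W → V) (t : W → ℤˣ) (x : V → ℤˣ) : W → ℤˣ := fun w => t w * x (φ w)

/-- A configuration on `V` is a configuration on the image of `W` and one on the rest. -/
def splitConfig (φ : W ↪ V) (t : W → ℤˣ) :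
    (V → ℤˣ) ≃ (W → ℤˣ) × ({v : V // v ∉ Set.range φ} → ℤˣ) :=
  Equiv.ofBijective (fun x => (pullConfig φ t x, fun v => x v)) <| by
    classical
    constructor
    · intro x y h
      rw [Prod.mk.injEq] at h
      funext v
      by_cases hv : v ∈ Set.range φ
      · obtain ⟨w, rfl⟩ := hv
        exact mul_left_cancel (congrFun h.1 w)
      · exact congrFun h.2 ⟨v, hv⟩
    · rintro ⟨y, z⟩
      refine ⟨fun v => if h : v ∈ Set.range φ then t h.choose * y h.choose else z ⟨v, h⟩, ?_⟩
      rw [Prod.mk.injEq]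
      constructor
      · funext w
        have h : φ w ∈ Set.range φ := ⟨w, rfl⟩
        have h' : h.choose = w := φ.injective h.choose_spec
        simp only [pullConfig, dif_pos h, h']
        rw [← mul_assoc, Int.units_mul_self, one_mul]
      · funext v
        simp only [dif_neg v.2]

theorem splitConfig_apply {V W : Type*} [DecidableEq V] [Fintype W] (φ : W ↪ V) (t : W → ℤˣ)
    (x : V → ℤˣ) :
    splitConfig φ t x =
      (pullConfig φ t x, fun v : {v : V // v ∉ Set.range φ} => x v) := rfl

open Classical Kronecker in
/-- The operator `A ⊗ 1`, where `A` acts on the image of `W` in `V`, with `Z_w` replaced by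
`t w Z_{φ w}`. -/
def lift (φ : W ↪ V) (t : W → ℤˣ) : Op W →ₐ[ℂ] Op V where
  toFun A := (A ⊗ₖ (1 : Matrix ({v : V // v ∉ Set.range φ} → ℤˣ) _ ℂ)).submatrix
    (splitConfig φ t) (splitConfig φ t)
  map_one' := by
    rw [Matrix.one_kronecker_one, Matrix.submatrix_one_equiv]
  map_mul' A B := by
    rw [Matrix.submatrix_mul_equiv, ← Matrix.mul_kronecker_mul, one_mul]
  map_zero' := by ext; simp
  map_add' A B := by ext; simp [add_mul]
  commutes' c := by
    ext x y
    simp only [Algebra.algebraMap_eq_smul_one, Matrix.submatrix_apply, Matrix.smul_kronecker,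
      Matrix.one_kronecker_one, Matrix.smul_apply]
    simp [Matrix.one_apply]

open Classical in
theorem lift_apply (φ : W ↪ V) (t : W → ℤˣ) (A : Op W) (x y : V → ℤˣ) :
    lift φ t A x y = A (pullConfig φ t x) (pullConfig φ t y) *
      if (∀ v, v ∉ Set.range φ → x v = y v) then 1 else 0 := by
  show A _ _ * (1 : Matrix _ _ ℂ) _ _ = _
  rw [Matrix.one_apply]
  congr 2
  rw [eq_iff_iff, funext_iff]
  exact ⟨fun h v hv => h ⟨v, hv⟩, fun h v => h v v.2⟩

theorem config_ext {V W : Type*} [DecidableEq V] [Fintype W] (φ : W ↪ V) (t : W → ℤˣ) {x y : V → ℤˣ}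
    (h1 : pullConfig φ t x = pullConfig φ t y) (h2 : ∀ v, v ∉ Set.range φ → x v = y v) :
    x = y :=
  (splitConfig φ t).injective (by
    rw [splitConfig_apply, splitConfig_apply, h1]
    congr 1
    funext v
    exact h2 v v.2)

theorem lift_diagonal (φ : W ↪ V) (t : W → ℤˣ) (d : (W → ℤˣ) → ℂ) :
    lift φ t (Matrix.diagonal d) = Matrix.diagonal fun x => d (pullConfig φ t x) := by
  classical
  ext x y
  rw [lift_apply, Matrix.diagonal_apply, Matrix.diagonal_apply]
  by_cases h : x = y
  · simp [h]
  · rw [if_neg h]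
    by_cases h1 : pullConfig φ t x = pullConfig φ t y
    · rw [if_neg (c := ∀ v, _), mul_zero]
      exact fun h2 => h (config_ext φ t h1 h2)
    · rw [if_neg h1, zero_mul]

theorem lift_pauliZ (φ : W ↪ V) (t : W → ℤˣ) (w : W) :
    lift φ t (pauliZ w) = ((t w : ℤ) : ℂ) • pauliZ (φ w) := by
  rw [pauliZ, lift_diagonal, pauliZ, ← Matrix.diagonal_smul]
  congr 1
  funext x
  simp [pullConfig]

theorem lift_pauliX (φ : W ↪ V) (t : W → ℤˣ) (w : W) :
    lift φ t (pauliX w) = pauliX (φ w) := by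
  classical
  ext x y
  have hp : pullConfig φ t (Function.update y (φ w) (-(y (φ w)))) =
      Function.update (pullConfig φ t y) w (-(pullConfig φ t y w)) := by
    funext u
    by_cases hu : u = w
    · subst hu; simp [pullConfig]
    · have : φ u ≠ φ w := fun h => hu (φ.injective h)
      simp [pullConfig, hu, this]
  have ho : ∀ v, v ∉ Set.range φ → Function.update y (φ w) (-(y (φ w))) v = y v := by
    intro v hv
    rw [Function.update_of_ne]
    rintro rfl
    exact hv ⟨w, rfl⟩
  rw [lift_apply]
  simp only [pauliX, Matrix.of_apply]
  rw [← hp]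
  by_cases h : x = Function.update y (φ w) (-(y (φ w)))
  · rw [if_pos h, if_pos (by rw [h]), if_pos (by rw [h]; exact ho), one_mul]
  · rw [if_neg h]
    by_cases h1 : pullConfig φ t x = pullConfig φ t (Function.update y (φ w) (-(y (φ w))))
    · rw [if_neg (c := ∀ v, _), mul_zero]
      exact fun h2 => h (config_ext φ t h1 fun v hv => (h2 v hv).trans (ho v hv).symm)
    · rw [if_neg h1, zero_mul]

theorem commute_lift_pauliX (φ : W ↪ V) (t : W → ℤˣ) (A : Op W) {v : V}
    (hv : v ∉ Set.range φ) : Commute (lift φ t A) (pauliX v) := by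
  classical
  have hp : ∀ x : V → ℤˣ, pullConfig φ t (Function.update x v (-(x v))) = pullConfig φ t x := by
    intro x
    funext w
    have : φ w ≠ v := fun h => hv ⟨w, h⟩
    simp [pullConfig, this]
  show _ = _
  ext x y
  rw [pauliX_mul_apply, mul_pauliX_apply, lift_apply, lift_apply, hp, hp]
  congr 2
  rw [eq_iff_iff]
  refine forall_congr' fun u => imp_congr_right fun _ => ?_
  by_cases hu : u = v
  · subst hu
    simp [neg_eq_iff_eq_neg]
  · simp [hu]

theorem commute_lift_pauliZ (φ : W ↪ V) (t : W → ℤˣ) (A : Op W) {v : V}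
    (hv : v ∉ Set.range φ) : Commute (lift φ t A) (pauliZ v) := by
  classical
  show _ = _
  ext x y
  rw [pauliZ, Matrix.mul_diagonal, Matrix.diagonal_mul, lift_apply]
  by_cases h : ∀ v, v ∉ Set.range φ → x v = y v
  · rw [h v hv, mul_comm]
  · rw [if_neg h, mul_zero, mul_zero, zero_mul]

theorem expect_plusState (A : Op V) :
    expect A (plusState V) = (∑ x, ∑ y, A x y).re / 2 ^ Fintype.card V := by
  have hc : (1 / Real.sqrt (2 ^ Fintype.card V)) * (1 / Real.sqrt (2 ^ Fintype.card V)) =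
      1 / (2 : ℝ) ^ Fintype.card V := by
    rw [div_mul_div_comm, one_mul, Real.mul_self_sqrt (by positivity)]
  have : star (plusState V) ⬝ᵥ Matrix.mulVec A (plusState V) =
      ((1 / 2 ^ Fintype.card V : ℝ) : ℂ) * ∑ x, ∑ y, A x y := by
    simp only [dotProduct, Matrix.mulVec, Pi.star_apply, plusState, Finset.mul_sum]
    refine Finset.sum_congr rfl fun x _ => Finset.sum_congr rfl fun y _ => ?_
    rw [← hc, Complex.star_def, Complex.conj_ofReal, Complex.ofReal_mul]
    ring
  rw [expect, this, Complex.re_ofReal_mul]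
  ring

/-- The state is a product state and the complementary factor of the operator is the identity, so
the other qubits contribute a factor 1. The signs `t` only permute the configurations summed over.
-/
theorem expect_lift_plusState (φ : W ↪ V) (t : W → ℤˣ) (A : Op W) :
    expect (lift φ t A) (plusState V) = expect A (plusState W) := by
  classical
  have hcard : Fintype.card V = Fintype.card W + Fintype.card {v : V // v ∉ Set.range φ} := by
    rw [← Set.card_range_of_injective φ.injective, Fintype.card_subtype_compl]
    have := Fintype.card_subtype_le (fun v => v ∈ Set.range φ)
    have h' : Fintype.card {v // v ∈ Set.range φ} = Fintype.card (Set.range φ) := rfl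
    omega
  have hsum : ∑ x, ∑ y, lift φ t A x y =
      (2 ^ Fintype.card {v : V // v ∉ Set.range φ} : ℕ) * ∑ a, ∑ b, A a b := by
    have : ∑ x, ∑ y, lift φ t A x y =
        ∑ p : (W → ℤˣ) × ({v : V // v ∉ Set.range φ} → ℤˣ),
          ∑ q : (W → ℤˣ) × ({v : V // v ∉ Set.range φ} → ℤˣ),
            A p.1 q.1 * (if p.2 = q.2 then 1 else 0) := by
      refine Fintype.sum_equiv (splitConfig φ t) _ _ fun x => ?_
      refine Fintype.sum_equiv (splitConfig φ t) _ _ fun y => ?_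
      rw [lift_apply]
      congr 2
      rw [eq_iff_iff, funext_iff]
      exact ⟨fun h v => h v v.2, fun h v hv => h ⟨v, hv⟩⟩
    rw [this]
    simp only [Fintype.sum_prod_type, mul_ite, mul_one, mul_zero, Finset.sum_ite_eq,
      Finset.mem_univ, if_true, Finset.sum_const, Finset.card_univ, Finset.mul_sum,
      Fintype.card_fun, Fintype.card_units_int, nsmul_eq_mul]
  rw [expect_plusState, expect_plusState, hsum, hcard, pow_add]
  have h2 : (((2 ^ Fintype.card {v : V // v ∉ Set.range φ} : ℕ) : ℂ) *
      ∑ a, ∑ b, A a b).re = 2 ^ Fintype.card {v : V // v ∉ Set.range φ} *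
        (∑ a, ∑ b, A a b).re := by
    rw [← Complex.ofReal_natCast, Complex.re_ofReal_mul]
    push_cast
    rfl
  rw [h2, mul_comm ((2 : ℝ) ^ Fintype.card W), mul_div_mul_left]
  positivity

end Lift

/-! ### Backward evolution of observables and symmetries -/

section Heisenberg

variable {V W : Type*} [Fintype V] [DecidableEq V] [Fintype W] [DecidableEq W]

theorem expect_mulVec (A U : Op V) (ψ : (V → ℤˣ) → ℂ) :
    expect A (Matrix.mulVec U ψ) = expect (U.conjTranspose * A * U) ψ := by
  rw [expect, expect, Matrix.star_mulVec, ← Matrix.dotProduct_mulVec, Matrix.mulVec_mulVec,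
    Matrix.mulVec_mulVec, Matrix.mul_assoc]

theorem qaoaUnitary_zero (H : Op V) (β γ : Fin 0 → ℝ) : qaoaUnitary H β γ = 1 := by
  simp [qaoaUnitary]

theorem qaoaState_zero (H : Op V) (β γ : Fin 0 → ℝ) : qaoaState H β γ = plusState V := by
  rw [qaoaState, qaoaUnitary_zero, Matrix.one_mulVec]

theorem qaoaUnitary_succ {p : ℕ} (H : Op V) (β γ : Fin (p + 1) → ℝ) :
    qaoaUnitary H β γ = NormedSpace.exp ((Complex.I * (β 0 : ℂ)) • mixer V) *
      NormedSpace.exp ((Complex.I * (γ 0 : ℂ)) • H) *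
        qaoaUnitary H (fun m => β m.succ) (fun m => γ m.succ) := by
  rw [qaoaUnitary, List.ofFn_succ, List.prod_cons, qaoaUnitary]

/-- The observable `A` evolved backwards by one level of QAOA. -/
def heisenbergStep (H : Op V) (β γ : ℝ) (A : Op V) : Op V :=
  NormedSpace.exp (-((Complex.I * (γ : ℂ)) • H)) *
    (NormedSpace.exp (-((Complex.I * (β : ℂ)) • mixer V)) * A *
      NormedSpace.exp ((Complex.I * (β : ℂ)) • mixer V)) *
    NormedSpace.exp ((Complex.I * (γ : ℂ)) • H)

theorem conjTranspose_exp_I_smul {H : Op V} (hH : H.IsHermitian) (γ : ℝ) :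
    (NormedSpace.exp ((Complex.I * (γ : ℂ)) • H)).conjTranspose =
      NormedSpace.exp (-((Complex.I * (γ : ℂ)) • H)) := by
  rw [← Matrix.exp_conjTranspose, Matrix.conjTranspose_smul, hH.eq]
  congr 1
  simp

/-- The factor with index `0` is leftmost in the product and acts last on the state, so it is the
first to be absorbed into the observable. This is the recursion for all inductions on the level. -/
theorem expect_qaoaState_succ {p : ℕ} {H : Op V} (hH : H.IsHermitian) (β γ : Fin (p + 1) → ℝ)
    (A : Op V) :
    expect A (qaoaState H β γ) = expect (heisenbergStep H (β 0) (γ 0) A)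
      (qaoaState H (fun m => β m.succ) (fun m => γ m.succ)) := by
  rw [qaoaState, qaoaUnitary_succ, ← Matrix.mulVec_mulVec, expect_mulVec, ← qaoaState]
  congr 1
  rw [Matrix.conjTranspose_mul, conjTranspose_exp_I_smul hH,
    conjTranspose_exp_I_smul mixer_isHermitian, heisenbergStep]
  noncomm_ring

theorem lift_heisenbergStep (φ : W ↪ V) (t : W → ℤˣ) (H A : Op W) (β γ : ℝ) :
    lift φ t (heisenbergStep H β γ A) =
      NormedSpace.exp (-((Complex.I * (γ : ℂ)) • lift φ t H)) *
    (NormedSpace.exp (-((Complex.I * (β : ℂ)) • lift φ t (mixer W))) * lift φ t A *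
      NormedSpace.exp ((Complex.I * (β : ℂ)) • lift φ t (mixer W))) *
    NormedSpace.exp ((Complex.I * (γ : ℂ)) • lift φ t H) := by
  simp only [heisenbergStep, map_mul, algHom_matrixExp, map_neg, map_smul]

/-- Expectation values in QAOA states are invariant under symmetries of the Hamiltonian. -/
theorem expect_lift_of_symmetry (φ : V ↪ V) (t : V → ℤˣ) {H : Op V} (hH : H.IsHermitian)
    (hφ : lift φ t H = H) {p : ℕ} (β γ : Fin p → ℝ) (A : Op V) :
    expect (lift φ t A) (qaoaState H β γ) = expect A (qaoaState H β γ) := by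
  have hB : lift φ t (mixer V) = mixer V := by
    simp only [mixer, map_sum, lift_pauliX]
    exact Equiv.sum_comp (Equiv.ofBijective φ (Finite.injective_iff_bijective.1 φ.injective))
      (fun v => (pauliX v : Op V))
  induction p generalizing A with
  | zero => simp only [qaoaState_zero, expect_lift_plusState]
  | succ p ih =>
    rw [expect_qaoaState_succ hH, expect_qaoaState_succ hH β γ A,
      ← ih _ _ (heisenbergStep H (β 0) (γ 0) A), lift_heisenbergStep, hφ, hB, heisenbergStep]

end Heisenberg

/-! ### Periodicity in the angles and existence of optimal angles -/

section MaximumAttained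

variable {V : Type*} [Fintype V] [DecidableEq V]

-- With the projection `P = (1 + X) / 2`, the map `(a, b) ↦ a P + b (1 - P)` is a continuous ring
-- homomorphism from `ℂ × ℂ` sending `(c, -c)` to `c X`. Both `exp c` and `exp (-c)` are 1.
open scoped Matrix.Norms.Operator in
theorem exp_smul_eq_one_of_involution {m : Type*} [Fintype m] [DecidableEq m] {X : Matrix m m ℂ}
    (hX : X * X = 1) {c : ℂ} (h1 : Complex.exp c = 1) :
    NormedSpace.exp (c • X) = 1 := by
  have hP : ((1 / 2 : ℂ) • (1 + X)) * ((1 / 2 : ℂ) • (1 + X)) = (1 / 2 : ℂ) • (1 + X) := by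
    rw [smul_mul_smul_comm, add_mul, mul_add, mul_add, hX]
    simp only [one_mul, mul_one]
    module
  have hX' : X = (1 / 2 : ℂ) • (1 + X) - (1 - (1 / 2 : ℂ) • (1 + X)) := by module
  generalize (1 / 2 : ℂ) • (1 + X) = P at hP hX'
  let f : ℂ × ℂ →+* Matrix m m ℂ :=
    { toFun := fun a => a.1 • P + a.2 • (1 - P)
      map_one' := by simp
      map_mul' := fun a b => by
        have h2 : P * (1 - P) = 0 := by rw [mul_sub, hP, mul_one, sub_self]
        have h3 : (1 - P) * P = 0 := by rw [sub_mul, hP, one_mul, sub_self]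
        have h4 : (1 - P) * (1 - P) = 1 - P := by rw [mul_sub, h3, mul_one, sub_zero]
        simp only [add_mul, mul_add, smul_mul_smul_comm, h2, h3, h4, hP, smul_zero, add_zero,
          zero_add, Prod.fst_mul, Prod.snd_mul]
      map_zero' := by simp
      map_add' := fun a b => by
        simp only [Prod.fst_add, Prod.snd_add, add_smul]
        abel }
  have hf : Continuous f := by
    show Continuous fun a : ℂ × ℂ => a.1 • P + a.2 • (1 - P)
    fun_prop
  have h5 : f (c, -c) = c • X := by
    show c • P + (-c) • (1 - P) = c • X
    rw [hX']
    module
  have h6 : NormedSpace.exp ((c, -c) : ℂ × ℂ) = 1 := by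
    refine Prod.ext ?_ ?_
    · rw [Prod.fst_exp, ← Complex.exp_eq_exp_ℂ]
      exact h1
    · rw [Prod.snd_exp, ← Complex.exp_eq_exp_ℂ]
      simp [Complex.exp_neg, h1]
  rw [← h5]
  exact (NormedSpace.map_exp f hf (c, -c)).symm.trans (by rw [h6, map_one])

theorem exp_smul_mixer_eq_one {c : ℂ} (hc : Complex.exp c = 1) :
    NormedSpace.exp (c • mixer V) = 1 := by
  suffices h : ∀ s : Finset V, NormedSpace.exp (c • ∑ v ∈ s, pauliX v : Op V) = 1 from
    h Finset.univ
  intro s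
  induction s using Finset.induction_on with
  | empty => simp
  | insert v s hv ih =>
    have hc' : Commute (pauliX v : Op V) (∑ w ∈ s, pauliX w) :=
      Commute.sum_right _ _ _ fun w _ => pauliX_mul_pauliX_comm v w
    rw [Finset.sum_insert hv, smul_add,
      Matrix.exp_add_of_commute _ _ ((hc'.smul_left c).smul_right c), ih,
      exp_smul_eq_one_of_involution (pauliX_sq v) hc, mul_one]

theorem exp_smul_diagonal_int_eq_one {c : ℂ} (hc : Complex.exp c = 1) (h : (V → ℤˣ) → ℤ) :
    NormedSpace.exp (c • (Matrix.diagonal fun x => (h x : ℂ) : Op V)) = 1 := by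
  rw [← Matrix.diagonal_smul, Matrix.exp_diagonal, ← Matrix.diagonal_one]
  congr 1
  funext x
  rw [Pi.exp_def, ← Complex.exp_eq_exp_ℂ]
  simp only [Pi.smul_apply, smul_eq_mul]
  rw [mul_comm, Complex.exp_int_mul, hc, one_zpow]

/-- Angles may be reduced modulo `2π` if the generator has integer eigenvalues. -/
theorem exp_I_smul_reduce {A : Op V}
    (hA : ∀ c : ℂ, Complex.exp c = 1 → NormedSpace.exp (c • A) = 1) (β : ℝ) :
    NormedSpace.exp ((Complex.I * (β : ℂ)) • A) = NormedSpace.exp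
      ((Complex.I * ((toIcoMod Real.two_pi_pos 0 β : ℝ) : ℂ)) • A) := by
  have h : (Complex.I * (β : ℂ)) • A =
      (Complex.I * ((toIcoMod Real.two_pi_pos 0 β : ℝ) : ℂ)) • A +
        ((toIcoDiv Real.two_pi_pos 0 β : ℂ) * (2 * Real.pi * Complex.I)) • A := by
    rw [← add_smul]
    congr 1
    have := congrArg (Complex.ofReal) (toIcoMod_add_toIcoDiv_zsmul Real.two_pi_pos 0 β)
    rw [← this]
    simp only [zsmul_eq_mul]
    push_cast
    ring
  rw [h, Matrix.exp_add_of_commute _ _ (((Commute.refl A).smul_left _).smul_right _),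
    hA _ (Complex.exp_int_mul_two_pi_mul_I _), mul_one]

theorem continuous_qaoaUnitary {p : ℕ} (H : Op V) :
    Continuous fun q : (Fin p → ℝ) × (Fin p → ℝ) => qaoaUnitary H q.1 q.2 := by
  induction p with
  | zero => simp only [qaoaUnitary_zero]; exact continuous_const
  | succ p ih =>
    simp only [qaoaUnitary_succ]
    refine Continuous.mul (Continuous.mul ?_ ?_) ?_
    · exact continuous_matrixExp.comp (by fun_prop)
    · exact continuous_matrixExp.comp (by fun_prop)
    · exact ih.comp (f := fun q : (Fin (p + 1) → ℝ) × (Fin (p + 1) → ℝ) =>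
        ((fun m => q.1 m.succ, fun m => q.2 m.succ) : (Fin p → ℝ) × (Fin p → ℝ))) (by fun_prop)

theorem continuous_expect_qaoaState {p : ℕ} (H A : Op V) :
    Continuous fun q : (Fin p → ℝ) × (Fin p → ℝ) => expect A (qaoaState H q.1 q.2) := by
  have h : Continuous fun q : (Fin p → ℝ) × (Fin p → ℝ) => qaoaState H q.1 q.2 :=
    (continuous_qaoaUnitary H).matrix_mulVec continuous_const
  exact Complex.continuous_re.comp (h.star.dotProduct (continuous_const.matrix_mulVec h))

/-- Optimal angles exist for a diagonal Hamiltonian with integer eigenvalues. -/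
theorem exists_isOptimalAngles (p : ℕ) {H : Op V} {h : (V → ℤˣ) → ℤ}
    (hH : H = Matrix.diagonal fun x => (h x : ℂ)) :
    ∃ β γ : Fin p → ℝ, IsOptimalAngles H β γ := by
  -- Both generators have integer spectrum, so angles matter only modulo `2π` and a maximum over
  -- this compact box is global.
  let K : Set ((Fin p → ℝ) × (Fin p → ℝ)) :=
    (Set.univ.pi fun _ => Set.Icc 0 (2 * Real.pi)) ×ˢ (Set.univ.pi fun _ => Set.Icc 0 (2 * Real.pi))
  have hK : IsCompact K :=
    (isCompact_univ_pi fun _ => isCompact_Icc).prod (isCompact_univ_pi fun _ => isCompact_Icc)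
  have hne : K.Nonempty := ⟨(0, 0), by
    constructor <;> exact fun i _ => ⟨le_rfl, Real.two_pi_pos.le⟩⟩
  obtain ⟨q, -, hq⟩ := hK.exists_isMaxOn hne (continuous_expect_qaoaState H H).continuousOn
  refine ⟨q.1, q.2, fun β γ => ?_⟩
  have hred : qaoaState H β γ = qaoaState H (fun m => toIcoMod Real.two_pi_pos 0 (β m))
      (fun m => toIcoMod Real.two_pi_pos 0 (γ m)) := by
    rw [qaoaState, qaoaState, qaoaUnitary, qaoaUnitary]
    congr 3
    funext m
    rw [exp_I_smul_reduce (fun c hc => exp_smul_mixer_eq_one hc) (β m),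
      exp_I_smul_reduce (fun c hc => by rw [hH]; exact exp_smul_diagonal_int_eq_one hc h) (γ m)]
  rw [hred]
  refine hq (a := ((fun m => toIcoMod Real.two_pi_pos 0 (β m)),
    (fun m => toIcoMod Real.two_pi_pos 0 (γ m)))) ?_
  have hmem : ∀ t : ℝ, toIcoMod Real.two_pi_pos 0 t ∈ Set.Icc 0 (2 * Real.pi) := fun t => by
    have := toIcoMod_mem_Ico Real.two_pi_pos 0 t
    rw [zero_add] at this
    exact ⟨this.1, this.2.le⟩
  exact ⟨fun m _ => hmem _, fun m _ => hmem _⟩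

end MaximumAttained

/-! ### Spreading of operator supports -/

section Support

variable {W : Type*} [Fintype W] [DecidableEq W]

/-- `A` acts as the identity on the qubits outside `S`. -/
def SupportedOn (S : Set W) (A : Op W) : Prop :=
  ∀ w, w ∉ S → Commute A (pauliX w) ∧ Commute A (pauliZ w)

/-- The mixer is a sum of commuting one-site terms. Those off `S` commute with `A` and cancel, so
the conjugation only involves sites of `S`. -/
theorem SupportedOn.mixer_conj {S : Set W} {A : Op W} (hA : SupportedOn S A) (c : ℂ) :
    SupportedOn S
      (NormedSpace.exp (-(c • mixer W)) * A * NormedSpace.exp (c • mixer W)) := by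
  classical
  have hsplit : c • mixer W = c • ∑ w with w ∈ S, pauliX w + c • ∑ w with w ∉ S, pauliX w := by
    rw [← smul_add, mixer, Finset.sum_filter_add_sum_filter_not]
  rw [hsplit, exp_conj_add]
  · intro w hw
    refine ⟨commute_exp_conj (Commute.smul_left ?_ c) (hA w hw).1,
      commute_exp_conj (Commute.smul_left ?_ c) (hA w hw).2⟩
    · exact Commute.sum_left _ _ _ fun v _ => pauliX_mul_pauliX_comm v w
    · refine Commute.sum_left _ _ _ fun v hv => commute_pauliX_pauliZ ?_
      rintro rfl
      exact hw (Finset.mem_filter.1 hv).2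
  · refine Commute.smul_left (Commute.smul_right ?_ c) c
    exact Commute.sum_left _ _ _ fun v _ => Commute.sum_right _ _ _ fun w _ =>
      pauliX_mul_pauliX_comm v w
  · refine Commute.smul_right ?_ c
    exact Commute.sum_right _ _ _ fun w hw => (hA w (Finset.mem_filter.1 hw).2).1

theorem pauliZ_comm (v w : W) : Commute (pauliZ v : Op W) (pauliZ w) := commute_diagonal _ _

/-- Conjugation by an Ising interaction enlarges the support by the neighbours. -/
theorem SupportedOn.ising_conj {ι : Type*} [Fintype ι] {a b : ι → W} {S S' : Set W}
    (hSS : S ⊆ S') (hab : ∀ i, a i ∈ S ∨ b i ∈ S → a i ∈ S' ∧ b i ∈ S')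
    {A : Op W} (hA : SupportedOn S A) (c : ℂ) :
    SupportedOn S' (NormedSpace.exp (-(c • ∑ i, pauliZ (a i) * pauliZ (b i))) * A *
      NormedSpace.exp (c • ∑ i, pauliZ (a i) * pauliZ (b i))) := by
  classical
  -- Bonds that do not meet `S` commute with `A` and cancel; the remaining ones lie entirely in
  -- `S'`.
  have hsplit : c • ∑ i, (pauliZ (a i) * pauliZ (b i) : Op W) =
      c • ∑ i with a i ∈ S ∨ b i ∈ S, pauliZ (a i) * pauliZ (b i) +
        c • ∑ i with ¬ (a i ∈ S ∨ b i ∈ S), pauliZ (a i) * pauliZ (b i) := by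
    rw [← smul_add, Finset.sum_filter_add_sum_filter_not]
  have hz : ∀ v w x : W, Commute (pauliZ v * pauliZ w : Op W) (pauliZ x) := fun v w x =>
    (pauliZ_comm v x).mul_left (pauliZ_comm w x)
  rw [hsplit, exp_conj_add]
  · intro w hw
    have hwS : w ∉ S := fun h => hw (hSS h)
    refine ⟨commute_exp_conj (Commute.smul_left ?_ c) (hA w hwS).1,
      commute_exp_conj (Commute.smul_left ?_ c) (hA w hwS).2⟩
    · refine Commute.sum_left _ _ _ fun i hi => ?_
      have h := hab i (Finset.mem_filter.1 hi).2
      have ha : w ≠ a i := fun h' => hw (h' ▸ h.1)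
      have hb : w ≠ b i := fun h' => hw (h' ▸ h.2)
      exact ((commute_pauliX_pauliZ ha).mul_right (commute_pauliX_pauliZ hb)).symm
    · exact Commute.sum_left _ _ _ fun i _ => hz _ _ _
  · refine Commute.smul_left (Commute.smul_right ?_ c) c
    exact Commute.sum_left _ _ _ fun v _ => Commute.sum_right _ _ _ fun w _ =>
      (hz _ _ _).mul_right (hz _ _ _)
  · refine Commute.smul_right ?_ c
    refine Commute.sum_right _ _ _ fun i hi => ?_
    have h := not_or.1 (Finset.mem_filter.1 hi).2
    exact (hA _ h.1).2.mul_right (hA _ h.2).2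

end Support

/-! ### Light cones on the ring and the bound `p / (p + 1)` -/

section LightCone

/-- The Ising chain with unit couplings on `2 P + 2` qubits. -/
def chainHamiltonian (P : ℕ) : Op (Fin (2 * P + 2)) :=
  ∑ j : Fin (2 * P + 1), pauliZ j.castSucc * pauliZ j.succ

/-- The `2 m + 2` qubits in the middle of the chain. -/
def chainCore (P m : ℕ) : Set (Fin (2 * P + 2)) := {w | P ≤ w + m ∧ (w : ℕ) ≤ P + 1 + m}

theorem SupportedOn.heisenbergStep_chain {P m : ℕ} {A : Op (Fin (2 * P + 2))}
    (hA : SupportedOn (chainCore P m) A) (β γ : ℝ) :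
    SupportedOn (chainCore P (m + 1)) (heisenbergStep (chainHamiltonian P) β γ A) := by
  refine SupportedOn.ising_conj (S := chainCore P m) ?_ ?_ (hA.mixer_conj _) _
  · rintro w ⟨h1, h2⟩
    constructor <;> omega
  · rintro j h
    simp only [chainCore, Set.mem_ofPred_eq, Fin.val_castSucc, Fin.val_succ] at h ⊢
    omega

theorem pauliZ_isHermitian {V : Type*} [Fintype V] [DecidableEq V] (v : V) :
    (pauliZ v : Op V).IsHermitian := by
  unfold Matrix.IsHermitian pauliZ
  rw [Matrix.diagonal_conjTranspose]
  congr 1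
  funext x
  simp

theorem pauliZ_mul_isHermitian {V : Type*} [Fintype V] [DecidableEq V] (v w : V) :
    (pauliZ v * pauliZ w : Op V).IsHermitian := by
  unfold Matrix.IsHermitian
  rw [Matrix.conjTranspose_mul, (pauliZ_isHermitian v).eq, (pauliZ_isHermitian w).eq]
  exact pauliZ_comm w v

theorem chainHamiltonian_isHermitian (P : ℕ) : (chainHamiltonian P).IsHermitian := by
  unfold Matrix.IsHermitian chainHamiltonian
  rw [Matrix.conjTranspose_sum]
  exact Finset.sum_congr rfl fun j _ => pauliZ_mul_isHermitian _ _

variable {n : ℕ} [NeZero n]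

theorem ringHamiltonian_isHermitian (J : ZMod n → ℤˣ) : (ringHamiltonian J).IsHermitian := by
  unfold Matrix.IsHermitian ringHamiltonian
  rw [Matrix.conjTranspose_sum]
  refine Finset.sum_congr rfl fun j _ => ?_
  rw [Matrix.conjTranspose_smul, (pauliZ_mul_isHermitian _ _).eq]
  simp

/-- The segment of the ring that starts at `a`. -/
def segment {n P : ℕ} (hn : 2 * P + 2 ≤ n) (a : ZMod n) : Fin (2 * P + 2) ↪ ZMod n where
  toFun j := a + ((j : ℕ) : ZMod n)
  inj' i j h := by
    have h' := (ZMod.natCast_eq_natCast_iff' _ _ _).1 (add_left_cancel h)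
    rw [Nat.mod_eq_of_lt (by omega), Nat.mod_eq_of_lt (by omega)] at h'
    exact Fin.ext h'

theorem segment_apply {n P : ℕ} (hn : 2 * P + 2 ≤ n) (a : ZMod n) (j : Fin (2 * P + 2)) :
    segment hn a j = a + ((j : ℕ) : ZMod n) := rfl

/-- The gauge transformation that makes the couplings on the segment equal to `1`. -/
def segmentGauge {n : ℕ} (J : ZMod n → ℤˣ) (a : ZMod n) (P : ℕ) (j : Fin (2 * P + 2)) : ℤˣ :=
  ∏ i ∈ Finset.range j, J (a + (i : ZMod n))

theorem sum_ring_eq_sum_range {M : Type*} [AddCommMonoid M] (F : ZMod n → M) (a : ZMod n) :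
    ∑ k, F k = ∑ i ∈ Finset.range n, F (a + (i : ZMod n)) := by
  rw [← Equiv.sum_comp (Equiv.addLeft a) F]
  refine Finset.sum_bij' (fun k _ => k.val) (fun i _ => (i : ZMod n)) ?_ ?_ ?_ ?_ ?_
  · intro k _; exact Finset.mem_range.2 (ZMod.val_lt k)
  · intro i _; exact Finset.mem_univ _
  · intro k _; exact ZMod.natCast_zmod_val k
  · intro i hi; exact ZMod.val_cast_of_lt (Finset.mem_range.1 hi)
  · intro k _; simp

variable {P : ℕ}

theorem lift_pauliZ_mul_pauliZ {V W : Type*} [Fintype V] [DecidableEq V] [Fintype W]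
    [DecidableEq W] (φ : W ↪ V) (t : W → ℤˣ) (v w : W) :
    lift φ t (pauliZ v * pauliZ w) =
      (((t v * t w : ℤˣ) : ℤ) : ℂ) • (pauliZ (φ v) * pauliZ (φ w)) := by
  rw [map_mul, lift_pauliZ, lift_pauliZ, smul_mul_smul_comm]
  push_cast
  rfl

theorem segmentGauge_mul {n : ℕ} (J : ZMod n → ℤˣ) (a : ZMod n) (j : Fin (2 * P + 1)) :
    segmentGauge J a P j.castSucc * segmentGauge J a P j.succ = J (a + ((j : ℕ) : ZMod n)) := by
  simp only [segmentGauge, Fin.val_castSucc, Fin.val_succ, Finset.prod_range_succ]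
  rw [← mul_assoc, Int.units_mul_self, one_mul]

theorem lift_segment_bond (hn : 2 * P + 2 ≤ n) (J : ZMod n → ℤˣ) (a : ZMod n)
    (j : Fin (2 * P + 1)) :
    lift (segment hn a) (segmentGauge J a P) (pauliZ j.castSucc * pauliZ j.succ) =
      ((J (a + ((j : ℕ) : ZMod n)) : ℤ) : ℂ) •
        (pauliZ (a + ((j : ℕ) : ZMod n)) * pauliZ (a + ((j : ℕ) : ZMod n) + 1)) := by
  rw [lift_pauliZ_mul_pauliZ, segmentGauge_mul]
  simp [segment_apply, add_assoc]

/-- The `2P + 1` bonds inside the segment form a gauge-transformed chain. The remaining bonds, which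
close the ring, touch the segment at its two end sites only. -/
theorem ringHamiltonian_eq_segment_add (hn : 2 * P + 2 ≤ n) (J : ZMod n → ℤˣ) (a : ZMod n) :
    ringHamiltonian J = lift (segment hn a) (segmentGauge J a P) (chainHamiltonian P) +
      ∑ i ∈ Finset.Ico (2 * P + 1) n, ((J (a + (i : ZMod n)) : ℤ) : ℂ) •
        (pauliZ (a + (i : ZMod n)) * pauliZ (a + (i : ZMod n) + 1)) := by
  rw [ringHamiltonian, sum_ring_eq_sum_range _ a,
    ← Finset.sum_range_add_sum_Ico _ (show 2 * P + 1 ≤ n by omega)]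
  congr 1
  rw [chainHamiltonian, map_sum, Finset.sum_range]
  exact Finset.sum_congr rfl fun j _ => (lift_segment_bond hn J a j).symm

/-- The site `a + i` is the last site of the segment for `i = 2P + 1`, its first site for `i = n`,
and outside it otherwise. These are exactly the sites met by the bonds that are not in the chain. -/
theorem commute_lift_pauliZ_outside (hn : 2 * P + 2 ≤ n) (t : Fin (2 * P + 2) → ℤˣ)
    (a : ZMod n) {A : Op (Fin (2 * P + 2))} (h0 : Commute A (pauliZ 0))
    (h1 : Commute A (pauliZ (Fin.last _))) {i : ℕ} (hi : 2 * P + 1 ≤ i) (hi' : i ≤ n) :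
    Commute (lift (segment hn a) t A) (pauliZ (a + (i : ZMod n))) := by
  have key : ∀ w, Commute A (pauliZ w) →
      Commute (lift (segment hn a) t A) (pauliZ (segment hn a w)) := by
    intro w hw
    -- As `t w` squares to 1, this `Z` is itself in the image of `lift`.
    have h2 : (pauliZ (segment hn a w) : Op (ZMod n)) =
        lift (segment hn a) t (((t w : ℤ) : ℂ) • pauliZ w) := by
      rw [map_smul, lift_pauliZ, smul_smul]
      have : ((t w : ℤ) : ℂ) * ((t w : ℤ) : ℂ) = 1 := by
        rw [← Int.cast_mul, ← Units.val_mul, Int.units_mul_self]; simp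
      rw [this, one_smul]
    rw [h2]
    show _ = _
    rw [← map_mul, ← map_mul, (hw.smul_right _).eq]
  rcases hi.eq_or_lt with rfl | hi
  · exact key (Fin.last _) h1
  rcases hi'.eq_or_lt with rfl | hi'
  · have := key 0 h0
    simpa [segment_apply] using this
  · apply commute_lift_pauliZ
    rintro ⟨j, hj⟩
    have h' := (ZMod.natCast_eq_natCast_iff' _ _ _).1 (add_left_cancel hj)
    rw [Nat.mod_eq_of_lt (by omega), Nat.mod_eq_of_lt (by omega)] at h'
    omega

/-- For `m < P` the end sites `0` and `2P + 1` are outside `chainCore P m`. The ring bonds missing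
from the chain then commute with the observable and drop out, even when `n = 2P + 2` and a single
bond joins the two ends. -/
theorem lift_segment_heisenbergStep (hn : 2 * P + 2 ≤ n) (J : ZMod n → ℤˣ) (a : ZMod n)
    {m : ℕ} (hm : m < P) {A : Op (Fin (2 * P + 2))} (hA : SupportedOn (chainCore P m) A)
    (β γ : ℝ) :
    heisenbergStep (ringHamiltonian J) β γ (lift (segment hn a) (segmentGauge J a P) A) =
      lift (segment hn a) (segmentGauge J a P) (heisenbergStep (chainHamiltonian P) β γ A) := by
  set L := lift (segment hn a) (segmentGauge J a P) with hL
  have hB : mixer (ZMod n) = L (mixer (Fin (2 * P + 2))) +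
      ∑ v with v ∉ Set.range (segment hn a), pauliX v := by
    rw [mixer, mixer, map_sum]
    simp only [hL, lift_pauliX]
    rw [← Finset.sum_filter_add_sum_filter_not _ (fun v => v ∈ Set.range (segment hn a))]
    congr 1
    rw [← Finset.sum_map Finset.univ (segment hn a) (fun v => pauliX v)]
    congr 1
    ext v
    simp
  have hX : ∀ C, Commute (L C) (∑ v with v ∉ Set.range (segment hn a), pauliX v) := fun C =>
    Commute.sum_right _ _ _ fun v hv => commute_lift_pauliX _ _ _ (Finset.mem_filter.1 hv).2
  have hR : ∀ C : Op (Fin (2 * P + 2)), Commute C (pauliZ 0) → Commute C (pauliZ (Fin.last _)) →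
      Commute (L C) (∑ i ∈ Finset.Ico (2 * P + 1) n, ((J (a + (i : ZMod n)) : ℤ) : ℂ) •
        (pauliZ (a + (i : ZMod n)) * pauliZ (a + (i : ZMod n) + 1))) := by
    intro C h0 h1
    refine Commute.sum_right _ _ _ fun i hi => Commute.smul_right (Commute.mul_right ?_ ?_) _
    · rw [Finset.mem_Ico] at hi
      exact commute_lift_pauliZ_outside hn _ a h0 h1 hi.1 hi.2.le
    · rw [Finset.mem_Ico] at hi
      have := commute_lift_pauliZ_outside hn (segmentGauge J a P) a h0 h1
        (show 2 * P + 1 ≤ i + 1 by omega) hi.2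
      rwa [Nat.cast_add, Nat.cast_one, ← add_assoc] at this
  have hz : ∀ w, Commute (chainHamiltonian P) (pauliZ w) := fun w =>
    Commute.sum_left _ _ _ fun j _ => (pauliZ_comm _ _).mul_left (pauliZ_comm _ _)
  have hA' := hA.mixer_conj (Complex.I * (β : ℂ))
  rw [lift_heisenbergStep, ← hL, heisenbergStep, hB, ringHamiltonian_eq_segment_add hn J a, ← hL,
    smul_add, smul_add,
    exp_conj_add (((hX _).smul_left _).smul_right _) ((hX _).smul_right _)]
  have hconj : NormedSpace.exp (-((Complex.I * (β : ℂ)) • L (mixer _))) * L A *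
      NormedSpace.exp ((Complex.I * (β : ℂ)) • L (mixer _)) =
        L (NormedSpace.exp (-((Complex.I * (β : ℂ)) • mixer _)) * A *
          NormedSpace.exp ((Complex.I * (β : ℂ)) • mixer _)) := by
    simp only [map_mul, hL, algHom_matrixExp, map_neg, map_smul]
  rw [hconj, exp_conj_add (((hR _ (hz _) (hz _)).smul_left _).smul_right _)
    ((hR _ (hA' _ ?_).2 (hA' _ ?_).2).smul_right _)]
  · simp only [chainCore, Set.mem_ofPred_eq, Fin.val_zero]
    omega
  · simp only [chainCore, Set.mem_ofPred_eq, Fin.val_last]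
    omega

/-- Expectation values in the light cone of a segment of the ring are those of a chain. -/
theorem expect_lift_segment (hn : 2 * P + 2 ≤ n) (J : ZMod n → ℤˣ) (a : ZMod n)
    {q m : ℕ} (hm : m + q = P) {A : Op (Fin (2 * P + 2))} (hA : SupportedOn (chainCore P m) A)
    (β γ : Fin q → ℝ) :
    expect (lift (segment hn a) (segmentGauge J a P) A) (qaoaState (ringHamiltonian J) β γ) =
      expect A (qaoaState (chainHamiltonian P) β γ) := by
  -- Each level absorbed widens the core by one site on each side, so `m + q = P` persists and the
  -- ends are not reached too early.
  induction q generalizing m A with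
  | zero => simp only [qaoaState_zero, expect_lift_plusState]
  | succ q ih =>
    rw [expect_qaoaState_succ (ringHamiltonian_isHermitian J),
      expect_qaoaState_succ (chainHamiltonian_isHermitian P),
      lift_segment_heisenbergStep hn J a (show m < P by omega) hA,
      ih (show m + 1 + q = P by omega) (hA.heisenbergStep_chain _ _)]

/-- The expectation value of the central bond of the chain in the level-`P` state. -/
def centralBond {P : ℕ} (β γ : Fin P → ℝ) : ℝ :=
  expect (pauliZ (Fin.castSucc ⟨P, by omega⟩ : Fin (2 * P + 2)) * pauliZ (Fin.succ ⟨P, by omega⟩))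
    (qaoaState (chainHamiltonian P) β γ)

/-- The segment starts at `k - P`, which puts the bond at `k` in its centre, and the gauge absorbs
`J k`. The right side knows neither the couplings, nor the bond, nor the length of the ring; in
particular it cannot detect frustration. -/
theorem expect_ring_bond (hn : 2 * P + 2 ≤ n) (J : ZMod n → ℤˣ) (k : ZMod n)
    (β γ : Fin P → ℝ) :
    expect (((J k : ℤ) : ℂ) • (pauliZ k * pauliZ (k + 1))) (qaoaState (ringHamiltonian J) β γ) =
      centralBond β γ := by
  have h := expect_lift_segment hn J (k - (P : ZMod n)) (q := P) (m := 0) (by omega)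
    (A := pauliZ (Fin.castSucc ⟨P, by omega⟩) * pauliZ (Fin.succ ⟨P, by omega⟩)) ?_ β γ
  · rw [lift_segment_bond] at h
    have hk : k - (P : ZMod n) + (((⟨P, by omega⟩ : Fin (2 * P + 1)) : ℕ) : ZMod n) = k :=
      sub_add_cancel _ _
    rw [hk] at h
    exact h
  · intro w hw
    have h1 : w ≠ Fin.castSucc ⟨P, by omega⟩ := by
      rintro rfl
      exact hw ⟨by simp, by simp⟩
    have h2 : w ≠ Fin.succ ⟨P, by omega⟩ := by
      rintro rfl
      exact hw ⟨by simp, by simp⟩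
    exact ⟨((commute_pauliX_pauliZ h1).mul_right (commute_pauliX_pauliZ h2)).symm,
      (pauliZ_comm _ _).mul_left (pauliZ_comm _ _)⟩

theorem expect_sum {V ι : Type*} [Fintype V] [DecidableEq V] (s : Finset ι) (A : ι → Op V)
    (ψ : (V → ℤˣ) → ℂ) : expect (∑ i ∈ s, A i) ψ = ∑ i ∈ s, expect (A i) ψ := by
  simp only [expect, Matrix.sum_mulVec, dotProduct_sum, Complex.re_sum]

theorem expect_ringHamiltonian (hn : 2 * P + 2 ≤ n) (J : ZMod n → ℤˣ) (β γ : Fin P → ℝ) :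
    expect (ringHamiltonian J) (qaoaState (ringHamiltonian J) β γ) = n * centralBond β γ := by
  conv_lhs => enter [1]; rw [ringHamiltonian]
  rw [expect_sum, Finset.sum_congr rfl fun k _ => expect_ring_bond hn J k β γ]
  simp [ZMod.card]

theorem expect_one_qaoaState {V : Type*} [Fintype V] [DecidableEq V] {p : ℕ} {H : Op V}
    (hH : H.IsHermitian) (β γ : Fin p → ℝ) : expect 1 (qaoaState H β γ) = 1 := by
  induction p with
  | zero =>
    have h : ((2 : ℂ) ^ Fintype.card V) = ((2 ^ Fintype.card V : ℝ) : ℂ) := by push_cast; rfl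
    rw [qaoaState_zero, expect_plusState]
    simp [Matrix.one_apply, h, -Complex.ofReal_pow]
  | succ p ih =>
    have h : ∀ C : Op V, NormedSpace.exp (-C) * NormedSpace.exp C = 1 := fun C => by
      rw [← Matrix.exp_add_of_commute _ _ (Commute.refl C).neg_left]
      simp
    rw [expect_qaoaState_succ hH, heisenbergStep, mul_one, h, mul_one, h, ih]

theorem expect_diagonal {V : Type*} [Fintype V] [DecidableEq V] (h : (V → ℤˣ) → ℤ)
    (ψ : (V → ℤˣ) → ℂ) :
    expect (Matrix.diagonal fun x => (h x : ℂ)) ψ = ∑ x, (h x : ℝ) * Complex.normSq (ψ x) := by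
  simp only [expect, dotProduct, Matrix.mulVec_diagonal, Complex.re_sum]
  refine Finset.sum_congr rfl fun x _ => ?_
  have : star ψ x * ((h x : ℂ) * ψ x) = (((h x : ℝ) * Complex.normSq (ψ x) : ℝ) : ℂ) := by
    rw [Complex.ofReal_mul, Complex.normSq_eq_conj_mul_self]
    simp only [Pi.star_apply, Complex.star_def, Complex.ofReal_intCast]
    ring
  rw [this, Complex.ofReal_re]

theorem expect_diagonal_le {V : Type*} [Fintype V] [DecidableEq V] {h : (V → ℤˣ) → ℤ} {M : ℤ}
    (hM : ∀ x, h x ≤ M) {ψ : (V → ℤˣ) → ℂ} (hψ : expect 1 ψ = 1) :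
    expect (Matrix.diagonal fun x => (h x : ℂ)) ψ ≤ M := by
  have h1 : (∑ x, Complex.normSq (ψ x)) = 1 := by
    rw [← hψ]
    have := expect_diagonal (fun _ => 1) ψ
    simpa using this.symm
  rw [expect_diagonal]
  calc _ ≤ ∑ x, (M : ℝ) * Complex.normSq (ψ x) :=
        Finset.sum_le_sum fun x _ =>
          mul_le_mul_of_nonneg_right (by exact_mod_cast hM x) (Complex.normSq_nonneg _)
    _ = M := by rw [← Finset.mul_sum, h1, mul_one]

/-- The energy of a configuration on the ring. -/
def ringEnergy (J x : ZMod n → ℤˣ) : ℤ := ∑ k, ((J k * (x k * x (k + 1)) : ℤˣ) : ℤ)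

theorem ringHamiltonian_eq_diagonal (J : ZMod n → ℤˣ) :
    ringHamiltonian J = Matrix.diagonal fun x => (ringEnergy J x : ℂ) := by
  have : ∀ k, ((J k : ℤ) : ℂ) • (pauliZ k * pauliZ (k + 1) : Op (ZMod n)) =
      Matrix.diagonal fun x => (((J k * (x k * x (k + 1)) : ℤˣ) : ℤ) : ℂ) := by
    intro k
    rw [pauliZ, pauliZ, Matrix.diagonal_mul_diagonal, ← Matrix.diagonal_smul]
    congr 1
    funext x
    simp
  rw [ringHamiltonian, Finset.sum_congr rfl fun k _ => this k]
  ext x y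
  rw [Matrix.sum_apply]
  by_cases h : x = y
  · subst h
    simp [ringEnergy]
  · simp [h]

theorem units_int_le_one (u : ℤˣ) : (u : ℤ) ≤ 1 := by
  rcases Int.units_eq_one_or u with rfl | rfl <;> simp

theorem ringEnergy_le (J x : ZMod n → ℤˣ) : ringEnergy J x ≤ n := by
  calc _ ≤ ∑ _k : ZMod n, (1 : ℤ) := Finset.sum_le_sum fun k _ => units_int_le_one _
    _ = n := by simp [ZMod.card]

/-- Every spin occurs in exactly two factors. -/
theorem prod_ring_bonds (x : ZMod n → ℤˣ) : ∏ k, (x k * x (k + 1)) = 1 := by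
  have h : ∏ k, x (k + 1) = ∏ k, x k := Equiv.prod_comp (Equiv.addRight (1 : ZMod n)) x
  rw [Finset.prod_mul_distrib, h, ← Finset.prod_mul_distrib]
  exact Finset.prod_eq_one fun k _ => Int.units_mul_self _

/-- On a frustrated ring at least one bond is violated. -/
theorem ringEnergy_le_of_frustrated {J : ZMod n → ℤˣ} (hJ : ∏ k, J k = -1) (x : ZMod n → ℤˣ) :
    ringEnergy J x ≤ n - 2 := by
  have hprod : ∏ k, (J k * (x k * x (k + 1))) = -1 := by
    rw [Finset.prod_mul_distrib, hJ, prod_ring_bonds, mul_one]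
  obtain ⟨k, hk⟩ : ∃ k, J k * (x k * x (k + 1)) = -1 := by
    by_contra! h
    rw [Finset.prod_eq_one fun k _ => (Int.units_eq_one_or _).resolve_right (h k)] at hprod
    exact absurd hprod (by decide)
  rw [ringEnergy, ← Finset.add_sum_erase _ _ (Finset.mem_univ k), hk]
  have : ∑ k ∈ Finset.univ.erase k, ((J k * (x k * x (k + 1)) : ℤˣ) : ℤ) ≤
      ∑ k ∈ Finset.univ.erase k, (1 : ℤ) := Finset.sum_le_sum fun k _ => units_int_le_one _
  have hcard : ((Finset.univ.erase k).card : ℤ) = n - 1 := by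
    rw [Finset.card_erase_of_mem (Finset.mem_univ k), Finset.card_univ, ZMod.card,
      Nat.cast_sub NeZero.one_le, Nat.cast_one]
  rw [Finset.sum_const, nsmul_eq_mul, mul_one, hcard] at this
  simp only [Units.val_neg, Units.val_one]
  linarith

/-- The universal bond value may be computed on any ring with at least `2P + 2` sites. On the
shortest one, with a single negative coupling, every configuration violates a bond, so the energy
`(2P + 2) * centralBond β γ` is at most `2P`. -/
theorem centralBond_le (β γ : Fin P → ℝ) : centralBond β γ ≤ (P : ℝ) / ((P : ℝ) + 1) := by
  let J : ZMod (2 * P + 2) → ℤˣ := fun k => if k = 0 then -1 else 1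
  have hJ : ∏ k, J k = -1 := by simp [J]
  have h := expect_diagonal_le (ringEnergy_le_of_frustrated hJ)
    (expect_one_qaoaState (ringHamiltonian_isHermitian J) β γ)
  rw [← ringHamiltonian_eq_diagonal, expect_ringHamiltonian le_rfl] at h
  push_cast at h
  rw [le_div_iff₀ (by positivity)]
  linarith

theorem energy_diagonal {V : Type*} [Fintype V] [DecidableEq V] (h : (V → ℤˣ) → ℤ)
    (x : V → ℤˣ) : energy (Matrix.diagonal fun x => (h x : ℂ)) x = h x := by
  simp [energy]

theorem energy_ringHamiltonian (J x : ZMod n → ℤˣ) :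
    energy (ringHamiltonian J) x = ringEnergy J x := by
  rw [ringHamiltonian_eq_diagonal, energy_diagonal]

theorem ringEnergy_of_satisfied {J x : ZMod n → ℤˣ} (h : ∀ k, J k = x k * x (k + 1)) :
    ringEnergy J x = n := by
  have : ∀ k, J k * (x k * x (k + 1)) = 1 := fun k => by rw [h, Int.units_mul_self]
  simp [ringEnergy, this, ZMod.card]

theorem maxEnergy_of_satisfied {J x : ZMod n → ℤˣ} (h : ∀ k, J k = x k * x (k + 1)) :
    maxEnergy (ringHamiltonian J) = n := by
  refine le_antisymm (ciSup_le fun y => ?_) ?_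
  · rw [energy_ringHamiltonian]
    exact_mod_cast ringEnergy_le J y
  · refine le_trans (le_of_eq ?_) (le_ciSup (Set.finite_range _).bddAbove x)
    rw [energy_ringHamiltonian, ringEnergy_of_satisfied h]
    simp

theorem approxRatio_of_satisfied {J x : ZMod n → ℤˣ} (h : ∀ k, J k = x k * x (k + 1)) :
    approxRatio (ringHamiltonian J) x = 1 := by
  rw [approxRatio, maxEnergy_of_satisfied h, energy_ringHamiltonian, ringEnergy_of_satisfied h,
    Int.cast_natCast]
  exact div_self (Nat.cast_ne_zero.2 (NeZero.ne n))

/-- Level-`p` QAOA on an unfrustrated ring with more than `2 p + 1` vertices has approximation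
ratio at most `p / (p + 1)`. -/
theorem exists_isQAOARatio_le {p : ℕ} (hn : 2 * p + 2 ≤ n) {J x : ZMod n → ℤˣ}
    (h : ∀ k, J k = x k * x (k + 1)) :
    ∃ ρ : ℝ, IsQAOARatio p (ringHamiltonian J) ρ ∧ ρ ≤ (p : ℝ) / ((p : ℝ) + 1) := by
  obtain ⟨β, γ, hopt⟩ := exists_isOptimalAngles p (ringHamiltonian_eq_diagonal J)
  have hn0 : (0 : ℝ) < n := Nat.cast_pos.2 (NeZero.pos n)
  refine ⟨_, ⟨⟨β, γ, rfl⟩, ?_⟩, ?_⟩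
  · rintro _ ⟨β', γ', rfl⟩
    rw [maxEnergy_of_satisfied h]
    exact div_le_div_of_nonneg_right (hopt β' γ') hn0.le
  · rw [maxEnergy_of_satisfied h, expect_ringHamiltonian hn, mul_div_cancel_left₀ _ hn0.ne']
    exact centralBond_le β γ

end LightCone

/-! ### Level-1 QAOA strictly beats the uniform superposition -/

section PositiveEnergy

variable {V : Type*} [Fintype V] [DecidableEq V]

open scoped Matrix.Norms.Operator in
theorem hasDerivAt_exp_mixer_mulVec (φ : (V → ℤˣ) → ℂ) (x : V → ℤˣ) :
    HasDerivAt (fun β : ℝ => Matrix.mulVec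
      (NormedSpace.exp ((Complex.I * (β : ℂ)) • mixer V)) φ x)
      (Complex.I * Matrix.mulVec (mixer V) φ x) 0 := by
  let ℓ : Op V →ₗ[ℝ] ℂ :=
    { toFun := fun A => Matrix.mulVec A φ x
      map_add' := fun A B => by rw [Matrix.add_mulVec]; rfl
      map_smul' := fun c A => by rw [Matrix.smul_mulVec]; rfl }
  have h := hasDerivAt_matrixExp_smul (Complex.I • mixer V) 0
  have h' := ℓ.toContinuousLinearMap.hasFDerivAt.comp_hasDerivAt (0 : ℝ) h
  have h1 : ∀ β : ℝ, (Complex.I * (β : ℂ)) • mixer V = β • (Complex.I • mixer V) := fun β => by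
    rw [mul_comm, mul_smul]
    rfl
  have h2 : ℓ.toContinuousLinearMap (NormedSpace.exp ((0 : ℝ) • Complex.I • mixer V) *
      Complex.I • mixer V) = Complex.I * Matrix.mulVec (mixer V) φ x := by
    rw [zero_smul, NormedSpace.exp_zero, one_mul]
    show Matrix.mulVec (Complex.I • mixer V) φ x = _
    rw [Matrix.smul_mulVec]
    rfl
  simp only [h1]
  rw [← h2]
  exact h'

theorem mixer_mulVec (φ : (V → ℤˣ) → ℂ) (x : V → ℤˣ) :
    Matrix.mulVec (mixer V) φ x = ∑ v, φ (Function.update x v (-(x v))) := by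
  rw [mixer, Matrix.sum_mulVec, Finset.sum_apply]
  refine Finset.sum_congr rfl fun v _ => ?_
  simp only [Matrix.mulVec, dotProduct, pauliX, Matrix.of_apply]
  rw [Finset.sum_eq_single (Function.update x v (-(x v)))]
  · simp
  · intro z _ hz
    rw [if_neg, zero_mul]
    rintro rfl
    simp at hz
  · simp

theorem hasDerivAt_normSq {f : ℝ → ℂ} {f' : ℂ} {t : ℝ} (hf : HasDerivAt f f' t) :
    HasDerivAt (fun u => Complex.normSq (f u)) (2 * ((f t).re * f'.re + (f t).im * f'.im)) t := by
  have h1 : HasDerivAt (fun u => (f u).re) f'.re t :=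
    Complex.reCLM.hasFDerivAt.comp_hasDerivAt t hf
  have h2 : HasDerivAt (fun u => (f u).im) f'.im t :=
    Complex.imCLM.hasFDerivAt.comp_hasDerivAt t hf
  have h := (h1.fun_mul h1).fun_add (h2.fun_mul h2)
  have h3 : 2 * ((f t).re * f'.re + (f t).im * f'.im) = f'.re * (f t).re + (f t).re * f'.re +
      (f'.im * (f t).im + (f t).im * f'.im) := by ring
  rw [h3]
  exact h

theorem mul_sin_nonneg {s : ℝ} (hs : |s| ≤ 1) : 0 ≤ s * Real.sin s := by
  rw [abs_le] at hs
  have hpi := Real.pi_gt_three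
  rcases le_total 0 s with h | h
  · exact mul_nonneg h (Real.sin_nonneg_of_nonneg_of_le_pi h (by linarith))
  · exact mul_nonneg_of_nonpos_of_nonpos h
      (Real.sin_nonpos_of_nonpos_of_neg_pi_le h (by linarith))

theorem mul_sin_pos {s : ℝ} (hs : |s| ≤ 1) (h0 : s ≠ 0) : 0 < s * Real.sin s := by
  rw [abs_le] at hs
  have hpi := Real.pi_gt_three
  rcases lt_or_gt_of_ne h0 with h | h
  · exact mul_pos_of_neg_of_neg h (Real.sin_neg_of_neg_of_neg_pi_lt h (by linarith))
  · exact mul_pos h (Real.sin_pos_of_pos_of_lt_pi h (by linarith))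

/-- The map that flips one spin. -/
def flipEquiv {V : Type*} [DecidableEq V] (v : V) : (V → ℤˣ) ≃ (V → ℤˣ) :=
  Function.Involutive.toPerm (fun x => Function.update x v (-(x v))) (fun x => by simp)

theorem flipEquiv_apply {V : Type*} [DecidableEq V] (v : V) (x : V → ℤˣ) :
    flipEquiv v x = Function.update x v (-(x v)) := rfl

theorem flipEquiv_flipEquiv {V : Type*} [DecidableEq V] (v : V) (x : V → ℤˣ) : flipEquiv v (flipEquiv v x) = x :=
  (flipEquiv v).symm_apply_apply x

/-- For a small angle `γ` the energy grows at first order in `β`. -/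
theorem sum_mul_sin_flip_pos {h : (V → ℤˣ) → ℤ} {v₀ : V} {x₀ : V → ℤˣ}
    (hne : h (flipEquiv v₀ x₀) ≠ h x₀) :
    ∃ γ : ℝ, 0 < ∑ x, ∑ v, (h x : ℝ) * Real.sin (γ * h x - γ * h (flipEquiv v x)) := by
  -- With `γ = 1 / M` all sine arguments `s` have `|s| ≤ 1 < π`, where `s * sin s` is nonnegative
  -- and vanishes only at `0`.
  obtain ⟨M, hM0, hM⟩ : ∃ M : ℝ, 0 < M ∧ ∀ x y, |(h x : ℝ) - h y| ≤ M := by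
    have hb : ∀ x, |(h x : ℝ)| ≤ ∑ z, |(h z : ℝ)| := fun x =>
      Finset.single_le_sum (f := fun z => |(h z : ℝ)|) (fun _ _ => abs_nonneg _)
        (Finset.mem_univ x)
    refine ⟨2 * ∑ z, |(h z : ℝ)| + 1, by positivity, fun x y => ?_⟩
    have := abs_sub (h x : ℝ) (h y)
    linarith [hb x, hb y]
  refine ⟨1 / M, ?_⟩
  have hsmall : ∀ x v, |1 / M * ((h x : ℝ) - h (flipEquiv v x))| ≤ 1 := fun x v => by
    rw [abs_mul, abs_of_pos (by positivity : 0 < 1 / M), one_div_mul_eq_div, div_le_one hM0]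
    exact hM _ _
  -- Averaging the terms of `x` and of its flip at `v` replaces `h x` by half the energy difference,
  -- because the sine is odd under the exchange. Each term becomes a multiple of `s * sin s`.
  have hsymm : ∀ v, ∑ x, (h x : ℝ) * Real.sin (1 / M * h x - 1 / M * h (flipEquiv v x)) =
      M / 2 * ∑ x, (1 / M * ((h x : ℝ) - h (flipEquiv v x))) *
        Real.sin (1 / M * ((h x : ℝ) - h (flipEquiv v x))) := by
    intro v
    have h1 := Equiv.sum_comp (flipEquiv v)
      (fun x => (h x : ℝ) * Real.sin (1 / M * h x - 1 / M * h (flipEquiv v x)))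
    simp only [flipEquiv_flipEquiv] at h1
    have h2 : ∀ x, (h (flipEquiv v x) : ℝ) * Real.sin (1 / M * h (flipEquiv v x) - 1 / M * h x) =
        -((h (flipEquiv v x) : ℝ) * Real.sin (1 / M * ((h x : ℝ) - h (flipEquiv v x)))) := by
      intro x
      rw [← mul_neg, ← Real.sin_neg]
      congr 2
      ring
    simp only [h2, Finset.sum_neg_distrib] at h1
    simp only [← mul_sub] at h1 ⊢
    rw [Finset.mul_sum]
    have h3 : ∀ x, M / 2 * ((1 / M * ((h x : ℝ) - h (flipEquiv v x))) *
        Real.sin (1 / M * ((h x : ℝ) - h (flipEquiv v x)))) =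
        1 / 2 * ((h x : ℝ) * Real.sin (1 / M * ((h x : ℝ) - h (flipEquiv v x)))) -
        1 / 2 * ((h (flipEquiv v x) : ℝ) *
          Real.sin (1 / M * ((h x : ℝ) - h (flipEquiv v x)))) := by
      intro x
      generalize Real.sin _ = S
      field_simp
    rw [Finset.sum_congr rfl fun x _ => h3 x, Finset.sum_sub_distrib, ← Finset.mul_sum,
      ← Finset.mul_sum]
    linarith
  rw [Finset.sum_comm, Finset.sum_congr rfl fun v _ => hsymm v, ← Finset.mul_sum]
  refine mul_pos (by positivity) ?_
  refine Finset.sum_pos' (fun v _ => Finset.sum_nonneg fun x _ => mul_sin_nonneg (hsmall x v))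
    ⟨v₀, Finset.mem_univ _, ?_⟩
  refine Finset.sum_pos' (fun x _ => mul_sin_nonneg (hsmall x v₀)) ⟨x₀, Finset.mem_univ _, ?_⟩
  refine mul_sin_pos (hsmall _ _) (mul_ne_zero (by positivity) (sub_ne_zero.2 ?_))
  exact_mod_cast hne.symm

/-- Level-`1` QAOA improves on the uniform superposition unless the Hamiltonian is constant. -/
theorem exists_expect_plusState_lt {H : Op V} {h : (V → ℤˣ) → ℤ}
    (hH : H = Matrix.diagonal fun x => (h x : ℂ)) {v₀ : V} {x₀ : V → ℤˣ}
    (hne : h (flipEquiv v₀ x₀) ≠ h x₀) :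
    ∃ β γ : Fin 1 → ℝ, expect H (plusState V) < expect H (qaoaState H β γ) := by
  obtain ⟨γ, hγ⟩ := sum_mul_sin_flip_pos hne
  -- At `β = 0` the phase layer leaves all probabilities unchanged, so the energy is that of the
  -- uniform state. If no angles did better, `β = 0` would be a local maximum with zero derivative,
  -- but the derivative is a positive multiple of the sum in `hγ`.
  by_contra! hmax
  set c : ℝ := 1 / Real.sqrt (2 ^ Fintype.card V) with hc
  have hc0 : 0 < c := by positivity
  -- The state after the phase layer and before the mixer.
  set φ : (V → ℤˣ) → ℂ := fun x => (c : ℂ) * Complex.exp (((γ * h x : ℝ) : ℂ) * Complex.I) with hφ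
  have hre : ∀ x, (φ x).re = c * Real.cos (γ * h x) := fun x => by
    rw [hφ, Complex.re_ofReal_mul, Complex.exp_ofReal_mul_I_re]
  have him : ∀ x, (φ x).im = c * Real.sin (γ * h x) := fun x => by
    rw [hφ, Complex.im_ofReal_mul, Complex.exp_ofReal_mul_I_im]
  have hstate : ∀ β : ℝ, qaoaState H (fun _ : Fin 1 => β) (fun _ => γ) =
      Matrix.mulVec (NormedSpace.exp ((Complex.I * (β : ℂ)) • mixer V)) φ := by
    intro β
    rw [qaoaState, qaoaUnitary_succ, qaoaUnitary_zero, mul_one, ← Matrix.mulVec_mulVec]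
    congr 1
    rw [hH, ← Matrix.diagonal_smul, Matrix.exp_diagonal]
    funext x
    rw [Matrix.mulVec_diagonal, Pi.exp_def, ← Complex.exp_eq_exp_ℂ, hφ]
    simp only [Pi.smul_apply, smul_eq_mul, plusState, ← hc]
    rw [mul_comm]
    congr 2
    push_cast
    ring
  let F : ℝ → ℝ := fun β => expect H (qaoaState H (fun _ : Fin 1 => β) (fun _ => γ))
  have hF : F = fun β : ℝ => ∑ x, (h x : ℝ) * Complex.normSq (Matrix.mulVec
      (NormedSpace.exp ((Complex.I * (β : ℂ)) • mixer V)) φ x) := by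
    funext β
    simp only [F, hstate]
    conv_lhs => rw [hH]
    exact expect_diagonal _ _
  have hφ0 : Matrix.mulVec (NormedSpace.exp ((Complex.I * ((0 : ℝ) : ℂ)) • mixer V)) φ = φ := by
    simp
  have hF0 : F 0 = expect H (plusState V) := by
    rw [hF, hH, expect_diagonal]
    simp only [hφ0]
    refine Finset.sum_congr rfl fun x _ => ?_
    congr 1
    rw [Complex.normSq_apply, hre, him, plusState, Complex.normSq_ofReal, ← hc]
    linear_combination c * c * Real.sin_sq_add_cos_sq (γ * h x)
  have hloc : IsLocalMax F 0 := Filter.Eventually.of_forall fun β => by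
    rw [hF0]
    exact hmax _ _
  have hderiv : HasDerivAt F (∑ x, (h x : ℝ) * (2 * ((φ x).re *
      (Complex.I * Matrix.mulVec (mixer V) φ x).re + (φ x).im *
        (Complex.I * Matrix.mulVec (mixer V) φ x).im))) 0 := by
    rw [hF]
    refine HasDerivAt.fun_sum fun x _ => HasDerivAt.const_mul _ ?_
    have := hasDerivAt_normSq (hasDerivAt_exp_mixer_mulVec φ x)
    rwa [hφ0] at this
  have hzero := hloc.hasDerivAt_eq_zero hderiv
  have hval : ∀ x, (h x : ℝ) * (2 * ((φ x).re *
      (Complex.I * Matrix.mulVec (mixer V) φ x).re + (φ x).im *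
        (Complex.I * Matrix.mulVec (mixer V) φ x).im)) =
      2 * (c * c) * ∑ v, (h x : ℝ) * Real.sin (γ * h x - γ * h (flipEquiv v x)) := by
    intro x
    rw [Complex.I_mul_re, Complex.I_mul_im, mixer_mulVec, Complex.im_sum, Complex.re_sum,
      ← Finset.sum_neg_distrib, Finset.mul_sum, Finset.mul_sum, ← Finset.sum_add_distrib,
      Finset.mul_sum, Finset.mul_sum, Finset.mul_sum]
    refine Finset.sum_congr rfl fun v _ => ?_
    rw [hre, him, hre, him, Real.sin_sub, flipEquiv_apply]
    ring
  rw [Finset.sum_congr rfl fun x _ => hval x, ← Finset.mul_sum] at hzero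
  have : 0 < 2 * (c * c) * ∑ x, ∑ v, (h x : ℝ) *
      Real.sin (γ * h x - γ * h (flipEquiv v x)) := by positivity
  exact this.ne' hzero

end PositiveEnergy

/-! ### Unfrustrated cycles: ground states and bond correlations -/

section SignedCycle

variable {V : Type*} [DecidableEq V]

/-- The hyperedge `{v, c v}`, or `∅` if `c v = v`. -/
def bond (c : Equiv.Perm V) (v : V) : Finset V := symmDiff {v} {c v}

theorem mem_bond {c : Equiv.Perm V} {v w : V} :
    w ∈ bond c v ↔ (w = v ∧ w ≠ c v) ∨ (w = c v ∧ w ≠ v) := by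
  simp [bond, Finset.mem_symmDiff]

theorem bond_eq_pair {c : Equiv.Perm V} {v : V} (h : c v ≠ v) : bond c v = {v, c v} := by
  ext w
  rw [mem_bond, Finset.mem_insert, Finset.mem_singleton]
  constructor
  · rintro (h | h)
    · exact Or.inl h.1
    · exact Or.inr h.1
  · rintro (rfl | rfl)
    · exact Or.inl ⟨rfl, h.symm⟩
    · exact Or.inr ⟨rfl, h⟩

/-- Every nonempty set of vertices closed under `c` contains all vertices. -/
def IsTransitive {V : Type*} (c : Equiv.Perm V) : Prop :=
  ∀ P : V → Prop, (∀ u, P u → P (c u)) → (∃ u, P u) → ∀ u, P u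

theorem IsTransitive.apply_ne {V : Type*} {c : Equiv.Perm V} (hc : IsTransitive c) [Fintype V]
    (hV : 1 < Fintype.card V) (v : V) : c v ≠ v := by
  intro h
  have h1 := hc (fun u => u = v) (fun u hu => by rw [hu, h]) ⟨v, rfl⟩
  exact absurd (Fintype.card_le_one_iff.2 fun a b => (h1 a).trans (h1 b).symm) (by omega)

/-- The hypergraph is the cycle `v → c v → c (c v) → ⋯`, with the couplings `s v * s (c v)` and
possibly a constant. -/
structure IsSignedCycle (G : WeightedHypergraph V) [Fintype V] (c : Equiv.Perm V)
    (s : V → ℤˣ) : Prop where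
  transitive : IsTransitive c
  mem_edges : ∀ e : Finset V, e.Nonempty → (e ∈ G.edges ↔ ∃ v, e = bond c v)
  -- On two vertices the bonds of both vertices are the same hyperedge, and their couplings add.
  weight_eq : ∀ e ∈ G.edges, e.Nonempty →
    G.weight e = ∑ v, if bond c v = e then (((s v * s (c v) : ℤˣ) : ℤ) : ℝ) else 0
  -- This includes the constant term: an integer spectrum is what makes optimal angles exist.
  weight_int : ∀ e ∈ G.edges, ∃ z : ℤ, G.weight e = z

variable [Fintype V]

/-- The energy of a configuration on the cycle. -/
def cycleEnergy {V : Type*} [Fintype V] (c : Equiv.Perm V) (s x : V → ℤˣ) : ℤ :=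
  ∑ v, ((s v * s (c v) * (x v * x (c v)) : ℤˣ) : ℤ)

theorem zProd_bond (c : Equiv.Perm V) (v : V) :
    (zProd (bond c v) : Op V) = pauliZ v * pauliZ (c v) := by
  rw [zProd, pauliZ, pauliZ, Matrix.diagonal_mul_diagonal]
  congr 1
  funext x
  by_cases h : c v = v
  · rw [bond, h, symmDiff_self, Finset.bot_eq_empty, Finset.prod_empty]
    have : ((x v : ℤ) : ℂ) * ((x v : ℤ) : ℂ) = 1 := by
      rw [← Int.cast_mul, ← Units.val_mul, Int.units_mul_self]; simp
    exact this.symm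
  · rw [bond_eq_pair h, Finset.prod_pair (Ne.symm h)]

/-- The interaction on the bond `{v, c v}` with its coupling. -/
def cycleTerm (c : Equiv.Perm V) (s : V → ℤˣ) (v : V) : Op V :=
  (((s v * s (c v) : ℤˣ) : ℤ) : ℂ) • (pauliZ v * pauliZ (c v))

theorem sum_cycleTerm_eq_diagonal (c : Equiv.Perm V) (s : V → ℤˣ) :
    ∑ v, cycleTerm c s v = Matrix.diagonal fun x => (cycleEnergy c s x : ℂ) := by
  have : ∀ v, cycleTerm c s v =
      Matrix.diagonal fun x => (((s v * s (c v) * (x v * x (c v)) : ℤˣ) : ℤ) : ℂ) := by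
    intro v
    rw [cycleTerm, pauliZ, pauliZ, Matrix.diagonal_mul_diagonal, ← Matrix.diagonal_smul]
    congr 1
    funext x
    simp
  rw [Finset.sum_congr rfl fun v _ => this v]
  ext x y
  rw [Matrix.sum_apply]
  by_cases h : x = y
  · subst h
    simp [cycleEnergy]
  · simp [h]

/-- Exchanging the sums over hyperedges and vertices turns the edge form into one term per vertex,
coinciding bonds included. A fixed vertex of `c` has an empty bond and its term is 1, so the number
of such vertices is subtracted from the constant. -/
theorem IsSignedCycle.hamiltonian_eq {G : WeightedHypergraph V} {c : Equiv.Perm V} {s : V → ℤˣ}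
    (h : IsSignedCycle G c s) :
    ∃ k : ℤ, G.hamiltonian = (k : ℂ) • (1 : Op V) + ∑ v, cycleTerm c s v := by
  have hempty : (zProd ∅ : Op V) = 1 := by simp [zProd]
  obtain ⟨k, hk⟩ : ∃ k : ℤ, ∑ e ∈ G.edges with ¬ e.Nonempty, (G.weight e : ℂ) • (zProd e : Op V) =
      (k : ℂ) • (1 : Op V) := by
    by_cases h0 : ∅ ∈ G.edges
    · obtain ⟨z, hz⟩ := h.weight_int _ h0
      refine ⟨z, ?_⟩
      rw [Finset.sum_eq_single ∅]
      · rw [hz, hempty, Complex.ofReal_intCast]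
      · intro e he hne
        exact absurd (Finset.not_nonempty_iff_eq_empty.1 (Finset.mem_filter.1 he).2) hne
      · intro hne
        exact absurd (Finset.mem_filter.2 ⟨h0, Finset.not_nonempty_empty⟩) hne
    · refine ⟨0, ?_⟩
      rw [Int.cast_zero, zero_smul]
      refine Finset.sum_eq_zero fun e he => absurd (Finset.mem_filter.1 he).1 ?_
      rwa [Finset.not_nonempty_iff_eq_empty.1 (Finset.mem_filter.1 he).2]
  have hterm : ∀ v, cycleTerm c s v =
      (((s v * s (c v) : ℤˣ) : ℤ) : ℂ) • (zProd (bond c v) : Op V) := fun v => by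
    rw [zProd_bond, cycleTerm]
  have hne : ∑ e ∈ G.edges with e.Nonempty, (G.weight e : ℂ) • (zProd e : Op V) =
      ∑ v with (bond c v).Nonempty, cycleTerm c s v := by
    have h1 : ∀ e ∈ G.edges.filter (fun e => e.Nonempty),
        (G.weight e : ℂ) • (zProd e : Op V) =
          ∑ v, if bond c v = e then cycleTerm c s v else 0 := by
      intro e he
      rw [Finset.mem_filter] at he
      rw [h.weight_eq e he.1 he.2, Complex.ofReal_sum, Finset.sum_smul]
      refine Finset.sum_congr rfl fun v _ => ?_
      split_ifs with hv
      · rw [hterm, hv, Complex.ofReal_intCast]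
      · simp
    rw [Finset.sum_congr rfl h1, Finset.sum_comm, Finset.sum_filter]
    refine Finset.sum_congr rfl fun v _ => ?_
    rw [Finset.sum_ite_eq]
    refine if_congr ?_ rfl rfl
    rw [Finset.mem_filter]
    exact ⟨fun hv => hv.2, fun hv => ⟨(h.mem_edges _ hv).2 ⟨v, rfl⟩, hv⟩⟩
  have hloop : ∀ v, ¬ (bond c v).Nonempty → cycleTerm c s v = 1 := by
    intro v hv
    have hv' : c v = v := by
      by_contra hcv
      exact hv ⟨v, by rw [bond_eq_pair hcv]; simp⟩
    rw [hterm, Finset.not_nonempty_iff_eq_empty.1 hv, hempty, hv', Int.units_mul_self]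
    simp
  refine ⟨k - (Finset.univ.filter fun v => ¬ (bond c v).Nonempty).card, ?_⟩
  rw [WeightedHypergraph.hamiltonian, ← Finset.sum_filter_not_add_sum_filter _
    (fun e => e.Nonempty), hk, hne,
    ← Finset.sum_filter_not_add_sum_filter Finset.univ (fun v => (bond c v).Nonempty),
    Finset.sum_congr rfl fun v hv => hloop v (Finset.mem_filter.1 hv).2, Finset.sum_const]
  push_cast
  rw [sub_smul, Nat.cast_smul_eq_nsmul]
  abel

theorem IsSignedCycle.exists_hamiltonian_eq_diagonal {G : WeightedHypergraph V}
    {c : Equiv.Perm V} {s : V → ℤˣ} (h : IsSignedCycle G c s) :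
    ∃ k : ℤ, G.hamiltonian = (k : ℂ) • (1 : Op V) + ∑ v, cycleTerm c s v ∧
      G.hamiltonian = Matrix.diagonal fun x => ((k + cycleEnergy c s x : ℤ) : ℂ) := by
  obtain ⟨k, hk⟩ := h.hamiltonian_eq
  refine ⟨k, hk, ?_⟩
  rw [hk, sum_cycleTerm_eq_diagonal, ← Matrix.diagonal_one, ← Matrix.diagonal_smul,
    Matrix.diagonal_add]
  congr 1
  funext x
  simp

theorem cycleEnergy_self {V : Type*} [Fintype V] (c : Equiv.Perm V) (s : V → ℤˣ) :
    cycleEnergy c s s = Fintype.card V := by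
  simp [cycleEnergy]

/-- Each of the `Fintype.card V` terms is at most 1, so reaching the total forces equality in all of
them. -/
theorem cycleEnergy_eq_card {V : Type*} [Fintype V] {c : Equiv.Perm V} {s x : V → ℤˣ}
    (h : (Fintype.card V : ℤ) ≤ cycleEnergy c s x) (v : V) :
    s v * s (c v) * (x v * x (c v)) = 1 := by
  by_contra hne
  have hv := (Int.units_eq_one_or (s v * s (c v) * (x v * x (c v)))).resolve_left hne
  have hlt : cycleEnergy c s x < ∑ _v : V, (1 : ℤ) := by
    refine Finset.sum_lt_sum (fun w _ => units_int_le_one _) ⟨v, Finset.mem_univ v, ?_⟩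
    rw [hv]
    decide
  simp only [Finset.sum_const, Finset.card_univ, nsmul_eq_mul, mul_one] at hlt
  exact absurd h (not_le.2 hlt)

/-- On an unfrustrated cycle the ground state is unique up to a global flip. -/
theorem IsTransitive.eq_or_neg {V : Type*} {c : Equiv.Perm V} (hc : IsTransitive c) {s x : V → ℤˣ}
    (h : ∀ v, s v * s (c v) * (x v * x (c v)) = 1) : ∃ ε : ℤˣ, ∀ v, x v = ε * s v := by
  rcases isEmpty_or_nonempty V with hV | ⟨⟨v₀⟩⟩
  · exact ⟨1, fun v => (IsEmpty.false v).elim⟩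
  · refine ⟨x v₀ * s v₀, hc (fun v => x v = x v₀ * s v₀ * s v) (fun u hu => ?_) ⟨v₀, ?_⟩⟩
    · have h1 := h u
      rw [hu] at h1
      have h2 := Int.units_mul_self (s u)
      generalize x v₀ * s v₀ = a at *
      rcases Int.units_eq_one_or a with rfl | rfl <;>
      rcases Int.units_eq_one_or (s u) with hs | hs <;>
      rcases Int.units_eq_one_or (s (c u)) with hs' | hs' <;>
      rcases Int.units_eq_one_or (x (c u)) with hx | hx <;>
      rw [hs, hs', hx] at h1 <;> rw [hs', hx] <;> revert h1 <;> decide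
    · rw [mul_assoc, Int.units_mul_self, mul_one]

theorem IsSignedCycle.eq_or_neg_of_max {G : WeightedHypergraph V} {c : Equiv.Perm V}
    {s x : V → ℤˣ} (h : IsSignedCycle G c s)
    (hx : ∀ y, energy G.hamiltonian y ≤ energy G.hamiltonian x) :
    ∃ ε : ℤˣ, ∀ v, x v = ε * s v := by
  obtain ⟨k, -, hk⟩ := h.exists_hamiltonian_eq_diagonal
  have h1 := hx s
  rw [hk, energy_diagonal, energy_diagonal, cycleEnergy_self] at h1
  refine h.transitive.eq_or_neg (cycleEnergy_eq_card ?_)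
  have : k + (Fintype.card V : ℤ) ≤ k + cycleEnergy c s x := by exact_mod_cast h1
  linarith

/-- The couplings need not be invariant under the rotation `c`, but the gauge signs `s u * s (c u)`
compensate. The combination permutes the terms and is a symmetry of the Hamiltonian. -/
theorem lift_cycleTerm (c : Equiv.Perm V) (s : V → ℤˣ) (v : V) :
    lift c.toEmbedding (fun u => s u * s (c u)) (cycleTerm c s v) = cycleTerm c s (c v) := by
  rw [cycleTerm, map_smul, lift_pauliZ_mul_pauliZ, smul_smul, cycleTerm]
  have h : s v * s (c v) * (s v * s (c v) * (s (c v) * s (c (c v)))) = s (c v) * s (c (c v)) := by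
    rw [← mul_assoc, Int.units_mul_self, one_mul]
  rw [← Int.cast_mul, ← Units.val_mul, h]
  rfl

theorem expect_add {V : Type*} [Fintype V] [DecidableEq V] (A B : Op V) (ψ : (V → ℤˣ) → ℂ) :
    expect (A + B) ψ = expect A ψ + expect B ψ := by
  simp only [expect, Matrix.add_mulVec, dotProduct_add, Complex.add_re]

theorem expect_int_smul {V : Type*} [Fintype V] [DecidableEq V] (k : ℤ) (A : Op V)
    (ψ : (V → ℤˣ) → ℂ) : expect ((k : ℂ) • A) ψ = k * expect A ψ := by
  simp only [expect, Matrix.smul_mulVec, dotProduct_smul, smul_eq_mul]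
  rw [← Complex.ofReal_intCast, Complex.re_ofReal_mul]

theorem isHermitian_of_eq_diagonal {V : Type*} [Fintype V] [DecidableEq V] {H : Op V} {h : (V → ℤˣ) → ℤ}
    (hH : H = Matrix.diagonal fun x => (h x : ℂ)) : H.IsHermitian := by
  rw [hH]
  unfold Matrix.IsHermitian
  rw [Matrix.diagonal_conjTranspose]
  congr 1
  funext x
  simp

/-- Flipping the spin at `v` permutes the configurations and changes the sign of every summand. -/
theorem expect_cycleTerm_plusState {c : Equiv.Perm V} (s : V → ℤˣ) {v : V} (hv : c v ≠ v) :
    expect (cycleTerm c s v) (plusState V) = 0 := by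
  rw [cycleTerm, expect_int_smul, expect_plusState]
  have h1 : ∑ x, ∑ y, (pauliZ v * pauliZ (c v) : Op V) x y =
      ∑ x : V → ℤˣ, ((x v : ℤ) : ℂ) * ((x (c v) : ℤ) : ℂ) := by
    refine Finset.sum_congr rfl fun x _ => ?_
    rw [pauliZ, pauliZ, Matrix.diagonal_mul_diagonal]
    simp [Matrix.diagonal_apply]
  have h2 : ∑ x : V → ℤˣ, ((x v : ℤ) : ℂ) * ((x (c v) : ℤ) : ℂ) =
      -∑ x : V → ℤˣ, ((x v : ℤ) : ℂ) * ((x (c v) : ℤ) : ℂ) := by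
    rw [← Finset.sum_neg_distrib]
    conv_lhs => rw [← Equiv.sum_comp (flipEquiv v)]
    refine Finset.sum_congr rfl fun x _ => ?_
    rw [flipEquiv_apply, Function.update_self, Function.update_of_ne hv]
    push_cast
    ring
  rw [h1, self_eq_neg.1 h2]
  simp

/-- At optimal angles all bond correlations have the sign of the coupling. -/
theorem IsSignedCycle.signUnit_expect_bond {G : WeightedHypergraph V} {c : Equiv.Perm V}
    {s : V → ℤˣ} (h : IsSignedCycle G c s) (hV : 1 < Fintype.card V) {β γ : Fin 1 → ℝ}
    (hopt : IsOptimalAngles G.hamiltonian β γ) (v : V) :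
    signUnit (expect (zProd (bond c v)) (qaoaState G.hamiltonian β γ)) = s v * s (c v) := by
  obtain ⟨k, hk, hd⟩ := h.exists_hamiltonian_eq_diagonal
  set H := G.hamiltonian with hH
  have hherm : H.IsHermitian := isHermitian_of_eq_diagonal hd
  have hcne := h.transitive.apply_ne hV
  have hsym : lift c.toEmbedding (fun u => s u * s (c u)) H = H := by
    rw [hk, map_add, map_smul, map_one, map_sum]
    congr 1
    rw [Finset.sum_congr rfl fun u _ => lift_cycleTerm c s u]
    exact Equiv.sum_comp c (cycleTerm c s)
  -- The symmetry carries the term at `u` to the one at `c u`, and transitivity reaches all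
  -- vertices.
  have hconst : ∀ u, expect (cycleTerm c s u) (qaoaState H β γ) =
      expect (cycleTerm c s v) (qaoaState H β γ) := by
    refine h.transitive _ (fun u hu => ?_) ⟨v, rfl⟩
    rw [← lift_cycleTerm, expect_lift_of_symmetry _ _ hherm hsym, hu]
  have hE : expect H (qaoaState H β γ) =
      k + Fintype.card V * expect (cycleTerm c s v) (qaoaState H β γ) := by
    have : ∀ ψ, expect H ψ = k * expect 1 ψ + ∑ u, expect (cycleTerm c s u) ψ := fun ψ => by
      rw [hk, expect_add, expect_int_smul, expect_sum]
    rw [this, expect_one_qaoaState hherm, mul_one, Finset.sum_congr rfl fun u _ => hconst u]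
    simp
  have hE0 : expect H (plusState V) = k := by
    have h1 := expect_one_qaoaState (p := 0) hherm 0 0
    rw [qaoaState_zero] at h1
    rw [hk, expect_add, expect_int_smul, expect_sum, h1,
      Finset.sum_eq_zero fun u _ => expect_cycleTerm_plusState s (hcne u)]
    simp
  -- The Hamiltonian is not constant: flipping one spin of the ground state `s` violates its bonds.
  obtain ⟨β', γ', hlt⟩ := exists_expect_plusState_lt hd (v₀ := v) (x₀ := s) (by
    intro heq
    have h1 : cycleEnergy c s (flipEquiv v s) = cycleEnergy c s s := add_left_cancel heq
    rw [cycleEnergy_self] at h1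
    have h2 := cycleEnergy_eq_card h1.ge v
    rw [flipEquiv_apply, Function.update_self, Function.update_of_ne (hcne v), neg_mul, mul_neg,
      Int.units_mul_self] at h2
    exact absurd h2 (by decide))
  have hpos : 0 < expect (cycleTerm c s v) (qaoaState H β γ) := by
    have h1 := hlt.trans_le (hopt β' γ')
    rw [hE, hE0] at h1
    have h2 : (0 : ℝ) < Fintype.card V := by exact_mod_cast (by omega : 0 < Fintype.card V)
    exact (mul_pos_iff_of_pos_left h2).1 (by linarith)
  rw [cycleTerm, expect_int_smul, ← zProd_bond] at hpos
  rcases Int.units_eq_one_or (s v * s (c v)) with hs | hs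
  · rw [hs] at hpos ⊢
    rw [signUnit, if_neg]
    simp at hpos
    exact not_lt.2 hpos.le
  · rw [hs] at hpos ⊢
    rw [signUnit, if_pos]
    simp at hpos
    exact hpos

end SignedCycle

/-! ### The family of instances and the local algorithm -/

section LocalAlgorithm

variable {n : ℕ}

theorem ringGraph_adj_succ (hn : 1 < n) (v : ZMod n) : (ringGraph n).Adj v (v + 1) := by
  have : Fact (1 < n) := ⟨hn⟩
  simp [SimpleGraph.circulantGraph]

/-- The edge `{v, v + 1}` of the ring. -/
def ringEdge (hn : 1 < n) (v : ZMod n) : (ringGraph n).edgeSet :=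
  ⟨s(v, v + 1), ringGraph_adj_succ hn v⟩

theorem ringEdge_mem_localEdges (hn : 1 < n) (v : ZMod n) :
    ringEdge hn v ∈ localEdges (ringGraph n) 1 v :=
  ⟨v + 1, (ringGraph_adj_succ hn v).toWalk,
    SimpleGraph.Walk.IsPath.of_adj (ringGraph_adj_succ hn v), by simp, by simp [ringEdge]⟩

theorem ringEdge_pred_mem_localEdges (hn : 1 < n) (v : ZMod n) :
    ringEdge hn (v - 1) ∈ localEdges (ringGraph n) 1 v := by
  have h : (ringGraph n).Adj v (v - 1) := by
    have := (ringGraph_adj_succ hn (v - 1)).symm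
    rwa [sub_add_cancel] at this
  refine ⟨v - 1, h.toWalk, SimpleGraph.Walk.IsPath.of_adj h, by simp, ?_⟩
  simp [ringEdge, Sym2.eq_swap]

theorem mapEdgeSet_ringEdge (hn : 1 < n) (v w : ZMod n) :
    (ringTranslation n v).mapEdgeSet (ringEdge hn w) = ringEdge hn (v + w) := by
  apply Subtype.ext
  show Sym2.map _ s(w, w + 1) = s(v + w, v + w + 1)
  simp [ringTranslation, add_assoc]

/-- The local rule that outputs `-1` iff both adjacent weights are negative. -/
def localRule (hn : 1 < n) (J : (ringGraph n).edgeSet → ℝ) (v : ZMod n) : ℤˣ :=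
  if J (ringEdge hn (v - 1)) < 0 ∧ J (ringEdge hn v) < 0 then -1 else 1

theorem isUniformLocalAlgorithm_localRule (hn : 1 < n) :
    IsUniformLocalAlgorithm (ringGraph n) 0 (ringTranslation n) 1 (localRule hn) := by
  refine ⟨⟨fun v J => if J ⟨_, ringEdge_pred_mem_localEdges hn v⟩ < 0 ∧
    J ⟨_, ringEdge_mem_localEdges hn v⟩ < 0 then -1 else 1, fun J v => rfl⟩,
    fun v => by simp [ringTranslation], fun J => if J ⟨_, ringEdge_pred_mem_localEdges hn 0⟩ < 0 ∧
    J ⟨_, ringEdge_mem_localEdges hn 0⟩ < 0 then -1 else 1, fun J v => ?_⟩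
  simp only [mapEdgeSet_ringEdge, localRule, zero_add, add_zero, sub_eq_add_neg]

variable [NeZero n]

/-- Coincidence with the endpoints exchanged would give `2 = 0` in `ZMod n`, which is excluded for
`n ≥ 3`. -/
theorem ringBond_injective {n : ℕ} (hn : 3 ≤ n) {v k : ZMod n} (h : s(v, v + 1) = s(k, k + 1)) :
    v = k := by
  rcases Sym2.eq_iff.1 h with h | h
  · exact h.1
  · exfalso
    have h2 : ((2 : ℕ) : ZMod n) = 0 := by
      have := h.2
      rw [h.1] at this
      have h3 : k + (1 + 1) = k + 0 := by rw [← add_assoc, this, add_zero]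
      have h4 := add_left_cancel h3
      push_cast
      rw [← h4]
      norm_num
    exact absurd (Nat.le_of_dvd (by norm_num) ((ZMod.natCast_eq_zero_iff _ _).1 h2)) (by omega)

theorem ringWeights_ringEdge (hn : 3 ≤ n) (J : ZMod n → ℤˣ) (v : ZMod n) :
    ringWeights J (ringEdge (by omega) v) = ((J v : ℤ) : ℝ) := by
  rw [ringWeights, Finset.sum_eq_single v]
  · simp [ringEdge]
  · intro k _ hk
    rw [if_neg]
    intro h
    exact hk (ringBond_injective hn h).symm
  · simp

/-- The configurations which are `1` off the multiples of `3`. -/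
def sparseConfig {n : ℕ} (a : Fin (n / 3) → ℤˣ) (v : ZMod n) : ℤˣ :=
  if h : v.val / 3 < n / 3 ∧ 3 ∣ v.val then a ⟨v.val / 3, h.1⟩ else 1

/-- The couplings satisfied by a configuration. -/
def satisfiedCouplings (x : ZMod n → ℤˣ) (k : ZMod n) : ℤˣ := x k * x (k + 1)

theorem sparseConfig_eq_one {n : ℕ} [NeZero n] (h3 : 3 ∣ n) (a : Fin (n / 3) → ℤˣ) {v : ZMod n}
    (hv : ZMod.castHom h3 (ZMod 3) v ≠ 0) : sparseConfig a v = 1 := by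
  rw [sparseConfig, dif_neg]
  rintro ⟨-, h⟩
  apply hv
  rw [ZMod.castHom_apply, ZMod.cast_eq_val]
  exact (ZMod.natCast_eq_zero_iff _ _).2 h

theorem sparseConfig_mul_three {n : ℕ} (h3 : 3 ∣ n) (a : Fin (n / 3) → ℤˣ) (i : Fin (n / 3)) :
    sparseConfig a ((3 * (i : ℕ) : ℕ) : ZMod n) = a i := by
  have hv : (((3 * (i : ℕ) : ℕ) : ZMod n)).val = 3 * i := ZMod.val_cast_of_lt (by omega)
  rw [sparseConfig, dif_pos]
  · congr 1
    apply Fin.ext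
    show _ / 3 = (i : ℕ)
    rw [hv]
    omega
  · rw [hv]
    exact ⟨by omega, dvd_mul_right _ _⟩

/-- The family of instances. -/
def instanceFamily (n : ℕ) [NeZero n] : Finset (ZMod n → ℤˣ) :=
  Finset.univ.image fun a : Fin (n / 3) → ℤˣ => satisfiedCouplings (sparseConfig a)

/-- The site `3i + 1` carries spin 1, so the coupling at `3i` is `a i` and the instance determines
`a`. -/
theorem card_instanceFamily (h3 : 3 ∣ n) : (instanceFamily n).card = 2 ^ (n / 3) := by
  rw [instanceFamily, Finset.card_image_of_injective]
  · simp
  · intro a b h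
    funext i
    have key : ∀ a : Fin (n / 3) → ℤˣ,
        satisfiedCouplings (sparseConfig a) ((3 * (i : ℕ) : ℕ) : ZMod n) = a i := by
      intro a
      rw [satisfiedCouplings, sparseConfig_mul_three h3, sparseConfig_eq_one h3, mul_one]
      simp only [map_add, map_natCast, map_one]
      push_cast
      rw [show (3 : ZMod 3) = 0 from rfl]
      simp
    rw [← key a, ← key b]
    exact congrFun h _

/-- At a multiple of 3 both neighbours are 1, so both adjacent couplings equal the spin. At any
other site the spin is 1, and two negative couplings would need both neighbours to be multiples of
3, which differ by 2. -/
theorem localRule_eq_sparseConfig (h3 : 3 ∣ n) (hn : 3 ≤ n) (a : Fin (n / 3) → ℤˣ) :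
    localRule (by omega) (ringWeights (satisfiedCouplings (sparseConfig a))) =
      sparseConfig a := by
  have hneg : ∀ u : ℤˣ, ((u : ℤ) : ℝ) < 0 ↔ u = -1 := fun u => by
    rcases Int.units_eq_one_or u with rfl | rfl <;> norm_num
  funext v
  rw [localRule, ringWeights_ringEdge hn, ringWeights_ringEdge hn]
  simp only [hneg, satisfiedCouplings, sub_add_cancel]
  set r := ZMod.castHom h3 (ZMod 3) with hr
  have h1 : r (v - 1) = r v - 1 := by rw [map_sub, map_one]
  have h2 : r (v + 1) = r v + 1 := by rw [map_add, map_one]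
  by_cases hv : r v = 0
  · rw [sparseConfig_eq_one h3 a (v := v - 1) (by rw [← hr, h1, hv]; decide),
      sparseConfig_eq_one h3 a (v := v + 1) (by rw [← hr, h2, hv]; decide), one_mul, mul_one]
    rcases Int.units_eq_one_or (sparseConfig a v) with h | h <;> rw [h] <;> simp
  · rw [sparseConfig_eq_one h3 a hv, mul_one, one_mul, if_neg]
    rintro ⟨h4, h5⟩
    have h6 : r v - 1 = 0 := by
      by_contra hne
      rw [sparseConfig_eq_one h3 a (v := v - 1) (by rw [← hr, h1]; exact hne)] at h4
      exact absurd h4 (by decide)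
    have h7 : r v + 1 = 0 := by
      by_contra hne
      rw [sparseConfig_eq_one h3 a (v := v + 1) (by rw [← hr, h2]; exact hne)] at h5
      exact absurd h5 (by decide)
    generalize r v = z at h6 h7
    revert h6 h7
    revert z
    decide

end LocalAlgorithm

open WeightedHypergraph

/-! ### Eliminating a vertex from a signed cycle -/

section Elimination

variable {V : Type*} [DecidableEq V]

/-- The cycle with the vertex `v` removed. -/
def removeVertex (c : Equiv.Perm V) (v : V) : Equiv.Perm {w : V // w ≠ v} :=
  -- The product fixes `v` and sends the predecessor of `v` to `c v`, bypassing `v`.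
  (Equiv.swap v (c v) * c).subtypePerm fun w => by
    have h : (Equiv.swap v (c v) * c) v = v := by simp
    constructor
    · intro hw hwv
      exact hw (by rw [hwv, h])
    · intro hw hwv
      exact hw ((Equiv.swap v (c v) * c).injective (hwv.trans h.symm))

theorem removeVertex_of_eq {c : Equiv.Perm V} {v : V} {w : {w : V // w ≠ v}} (h : c w = v) :
    (removeVertex c v w : V) = c v := by
  simp [removeVertex, h]

theorem removeVertex_of_ne {c : Equiv.Perm V} {v : V} {w : {w : V // w ≠ v}} (h : c w ≠ v) :
    (removeVertex c v w : V) = c w := by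
  have h' : c w ≠ c v := fun h' => w.2 (c.injective h')
  simp [removeVertex, Equiv.swap_apply_of_ne_of_ne h h']

theorem IsTransitive.removeVertex {c : Equiv.Perm V} (hc : IsTransitive c) {v : V}
    (hv : c v ≠ v) : IsTransitive (removeVertex c v) := by
  rintro P hP ⟨w₀, hw₀⟩ w
  -- The predicate is extended to `v` by its value at `c v`; the extension is closed under `c`.
  have key := hc (fun u => ∀ u' : {w : V // w ≠ v},
    (u' : V) = (if u = v then c v else u) → P u') ?_ ⟨w₀, ?_⟩ w
  · exact key w (by rw [if_neg w.2])
  · intro u hu u' hu'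
    by_cases huv : u = v
    · subst huv
      rw [if_neg hv] at hu'
      exact hu u' (by rw [if_pos rfl, hu'])
    · have hPu := hP _ (hu ⟨u, huv⟩ (by rw [if_neg huv]))
      have : QAOA.removeVertex c v ⟨u, huv⟩ = u' := by
        apply Subtype.ext
        by_cases hcu : c u = v
        · rw [removeVertex_of_eq (w := ⟨u, huv⟩) hcu, hu', if_pos hcu]
        · rw [removeVertex_of_ne (w := ⟨u, huv⟩) hcu, hu', if_neg hcu]
      rwa [this] at hPu
  · intro u' hu'
    rw [if_neg w₀.2] at hu'
    rwa [Subtype.ext hu']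

theorem mem_reduceEdge {f e : Finset V} {v : V} {w : {w : V // w ≠ v}} :
    w ∈ reduceEdge f v e ↔ (w : V) ∈ (if v ∈ e then symmDiff e f else e) := by
  rw [reduceEdge, Finset.mem_subtype]

theorem reduceEdge_self {f : Finset V} {v : V} (hv : v ∈ f) : reduceEdge f v f = ∅ := by
  ext w
  rw [mem_reduceEdge, if_pos hv, symmDiff_self]
  simp

theorem nonempty_of_reduceEdge {f e : Finset V} {v : V} (h : (reduceEdge f v e).Nonempty) :
    e.Nonempty := by
  rw [Finset.nonempty_iff_ne_empty] at h ⊢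
  rintro rfl
  apply h
  ext w
  rw [mem_reduceEdge]
  simp

theorem mem_bond_right {c : Equiv.Perm V} {v w : V} (hv : c v ≠ v) (h : c w = v) :
    v ∈ bond c w := by
  rw [mem_bond]
  refine Or.inr ⟨h.symm, ?_⟩
  rintro rfl
  exact hv h

theorem mem_bond_left {c : Equiv.Perm V} {v : V} (hv : c v ≠ v) : v ∈ bond c v :=
  mem_bond.2 (Or.inl ⟨rfl, hv.symm⟩)

/-- Elimination merges the two bonds at `v` and leaves the others as they are. -/
theorem reduceEdge_bond_of_ne {c : Equiv.Perm V} {v : V} (f : Finset V) {w : {w : V // w ≠ v}}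
    (h : c w ≠ v) : reduceEdge f v (bond c w) = bond (removeVertex c v) w := by
  have hv : v ∉ bond c w := by
    rw [mem_bond]
    rintro (h' | h')
    · exact w.2 h'.1.symm
    · exact h h'.1.symm
  ext u
  rw [mem_reduceEdge, if_neg hv, mem_bond, mem_bond]
  simp only [ne_eq, Subtype.ext_iff, removeVertex_of_ne h]

theorem symmDiff_bond {c : Equiv.Perm V} {v w : V} (h : c w = v) :
    symmDiff (bond c w) (bond c v) = symmDiff {w} {c v} := by
  rw [bond, bond, h, symmDiff_assoc, symmDiff_symmDiff_cancel_left]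

theorem mem_bond_removeVertex_of_eq {c : Equiv.Perm V} {v : V} {w u : {w : V // w ≠ v}}
    (h : c w = v) :
    u ∈ bond (removeVertex c v) w ↔ (u : V) ∈ (symmDiff {(w : V)} {c v} : Finset V) := by
  rw [mem_bond, Finset.mem_symmDiff]
  simp only [ne_eq, Subtype.ext_iff, removeVertex_of_eq h, Finset.mem_singleton]

variable {c : Equiv.Perm V} {v u : V}

/-- The effect of an elimination on the bonds, up to a relabelling `τ`. -/
theorem exists_relabelling (s : V → ℤˣ) (hv : c v ≠ v) (hu : v ∈ bond c u) :
    ∃ τ : Equiv.Perm V, reduceEdge (bond c u) v (bond c (τ v)) = ∅ ∧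
      ∀ w : {w : V // w ≠ v},
        reduceEdge (bond c u) v (bond c (τ w)) = bond (removeVertex c v) w ∧
          (if v ∈ bond c (τ w) then s u * s (c u) else 1) * (s (τ w) * s (c (τ w))) =
            s w * s (removeVertex c v w) := by
  have hother : ∀ w : {w : V // w ≠ v}, c w ≠ v → v ∉ bond c w := by
    intro w hw hv
    rcases mem_bond.1 hv with h' | h'
    · exact w.2 h'.1.symm
    · exact hw h'.1.symm
  rcases mem_bond.1 hu with ⟨huv, -⟩ | ⟨huv, hne⟩
  -- The constraint is the bond leaving `v`: it becomes empty, and the entering bond turns into the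
  -- merged one without relabelling.
  · subst huv
    refine ⟨1, reduceEdge_self hu, fun w => ?_⟩
    rw [Equiv.Perm.one_apply]
    by_cases hw : c w = v
    · refine ⟨?_, ?_⟩
      · ext x
        rw [mem_reduceEdge, if_pos (mem_bond_right hv hw), symmDiff_bond hw,
          mem_bond_removeVertex_of_eq hw]
      · rw [if_pos (mem_bond_right hv hw), removeVertex_of_eq hw, hw]
        calc s v * s (c v) * (s w * s v) = s v * s v * (s w * s (c v)) := by
              ac_rfl
          _ = _ := by rw [Int.units_mul_self, one_mul]
    · exact ⟨reduceEdge_bond_of_ne _ hw, by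
        rw [if_neg (hother w hw), one_mul, removeVertex_of_ne hw]⟩
  · have huv' : c u = v := huv.symm
    -- The constraint is the bond entering `v` from `u`: it becomes empty, and the merged bond,
    -- labelled `u` in the shorter cycle, comes from the bond of `v`. Hence the swap.
    refine ⟨Equiv.swap v u, ?_, fun w => ?_⟩
    · rw [Equiv.swap_apply_left]
      exact reduceEdge_self hu
    by_cases hw : c w = v
    · have hwu : (w : V) = u := c.injective (hw.trans huv)
      rw [hwu, Equiv.swap_apply_right]
      refine ⟨?_, ?_⟩
      · ext x
        rw [mem_reduceEdge, if_pos (mem_bond_left hv), symmDiff_comm, symmDiff_bond huv',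
          mem_bond_removeVertex_of_eq hw, hwu]
      · rw [if_pos (mem_bond_left hv), removeVertex_of_eq hw, huv']
        calc s u * s v * (s v * s (c v)) = s v * s v * (s u * s (c v)) := by ac_rfl
          _ = _ := by rw [Int.units_mul_self, one_mul]
    · have hwu : (w : V) ≠ u := fun h => hw (by rw [h, huv'])
      rw [Equiv.swap_apply_of_ne_of_ne w.2 hwu]
      exact ⟨reduceEdge_bond_of_ne _ hw, by
        rw [if_neg (hother w hw), one_mul, removeVertex_of_ne hw]⟩

/-- The hyperedge consists of `v` and one other vertex `o`, so the recovered spin is `(s o * s v) *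
(ε * s o) = ε * s v`. -/
theorem extend_eq {s : V → ℤˣ} (hu : v ∈ bond c u) {y : {w : V // w ≠ v} → ℤˣ}
    {ε : ℤˣ} (hy : ∀ w, y w = ε * s w) (w : V) :
    extend (bond c u) v (s u * s (c u)) y w = ε * s w := by
  obtain ⟨o, hov, hmem, hs⟩ : ∃ o, o ≠ v ∧ (∀ x, x ≠ v → (x ∈ bond c u ↔ x = o)) ∧
      s u * s (c u) = s o * s v := by
    rcases mem_bond.1 hu with ⟨rfl, hne⟩ | ⟨rfl, hne⟩
    · refine ⟨c v, hne.symm, fun x hx => ?_, mul_comm _ _⟩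
      rw [mem_bond]
      tauto
    · refine ⟨u, hne.symm, fun x hx => ?_, rfl⟩
      rw [mem_bond]
      tauto
  rw [extend]
  split_ifs with h
  · have hf : (bond c u).subtype (fun w => w ≠ v) = {⟨o, hov⟩} := by
      ext x
      rw [Finset.mem_subtype, Finset.mem_singleton, hmem _ x.2, Subtype.ext_iff]
    rw [hf, Finset.prod_singleton, hy, hs, h]
    calc s o * s v * (ε * s o) = s o * s o * (ε * s v) := by ac_rfl
      _ = _ := by rw [Int.units_mul_self, one_mul]
  · exact hy _

variable [Fintype V]

/-- The sign of the constraint is the coupling of the eliminated bond. With `w` the predecessor of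
`v`, the merged bond has coupling `(s w * s v) * (s v * s (c v)) = s w * s (c v)`, again of the
required form for the restricted `s`. The bond used as constraint becomes part of the constant. -/
theorem IsSignedCycle.eliminate {G : WeightedHypergraph V} {s : V → ℤˣ}
    (h : IsSignedCycle G c s) (hv : c v ≠ v) (hu : v ∈ bond c u) :
    IsSignedCycle (G.eliminate (bond c u) v (s u * s (c u))) (removeVertex c v)
      (fun w => s w) := by
  obtain ⟨τ, hτ0, hτ⟩ := exists_relabelling s hv hu
  refine ⟨h.transitive.removeVertex hv, ?_, ?_, ?_⟩
  · intro e' he'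
    simp only [WeightedHypergraph.eliminate, Finset.mem_image]
    constructor
    · rintro ⟨e, he, rfl⟩
      obtain ⟨w, rfl⟩ := (h.mem_edges e (nonempty_of_reduceEdge he')).1 he
      obtain ⟨w, rfl⟩ := τ.surjective w
      by_cases hw : w = v
      · rw [hw, hτ0] at he'
        exact absurd he' Finset.not_nonempty_empty
      · exact ⟨⟨w, hw⟩, (hτ ⟨w, hw⟩).1⟩
    · rintro ⟨w, rfl⟩
      rw [← (hτ w).1] at he' ⊢
      exact ⟨_, (h.mem_edges _ (nonempty_of_reduceEdge he')).2 ⟨_, rfl⟩, rfl⟩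
  · intro e' _ he'
    simp only [WeightedHypergraph.eliminate]
    have h1 : ∀ e ∈ G.edges.filter (fun e => reduceEdge (bond c u) v e = e'),
        (if v ∈ e then (((s u * s (c u) : ℤˣ) : ℤ) : ℝ) else 1) * G.weight e =
          ∑ w, if bond c w = e then
            ((((if v ∈ bond c w then s u * s (c u) else 1) * (s w * s (c w)) : ℤˣ) : ℤ) : ℝ)
            else 0 := by
      intro e he
      rw [Finset.mem_filter] at he
      rw [h.weight_eq e he.1 (nonempty_of_reduceEdge (he.2 ▸ he')), Finset.mul_sum]
      refine Finset.sum_congr rfl fun w _ => ?_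
      by_cases hw : bond c w = e
      · rw [if_pos hw, if_pos hw, hw]
        split_ifs <;> simp
      · rw [if_neg hw, if_neg hw, mul_zero]
    rw [Finset.sum_congr rfl h1, Finset.sum_comm]
    have h2 : ∀ w, (∑ e ∈ G.edges with reduceEdge (bond c u) v e = e', if bond c w = e then
        ((((if v ∈ bond c w then s u * s (c u) else 1) * (s w * s (c w)) : ℤˣ) : ℤ) : ℝ)
            else 0) = if reduceEdge (bond c u) v (bond c w) = e' then
        ((((if v ∈ bond c w then s u * s (c u) else 1) * (s w * s (c w)) : ℤˣ) : ℤ) : ℝ)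
            else 0 := by
      intro w
      rw [Finset.sum_ite_eq]
      refine if_congr ?_ rfl rfl
      rw [Finset.mem_filter]
      exact ⟨fun hw => hw.2, fun hw => ⟨(h.mem_edges _
        (nonempty_of_reduceEdge (hw ▸ he'))).2 ⟨w, rfl⟩, hw⟩⟩
    -- After relabelling by `τ`, the term at `v` belongs to the empty hyperedge and contributes
    -- nothing to the nonempty `e'`.
    rw [Finset.sum_congr rfl fun w _ => h2 w, ← Equiv.sum_comp τ,
      Fintype.sum_eq_add_sum_subtype_ne _ v, hτ0, if_neg (Finset.nonempty_iff_ne_empty.1 he').symm,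
      zero_add]
    refine Finset.sum_congr rfl fun w _ => ?_
    rw [(hτ w).1, (hτ w).2]
  · intro e' _
    simp only [WeightedHypergraph.eliminate]
    have h1 : ∀ e ∈ G.edges.filter (fun e => reduceEdge (bond c u) v e = e'), ∃ z : ℤ,
        (if v ∈ e then (((s u * s (c u) : ℤˣ) : ℤ) : ℝ) else 1) * G.weight e = z := by
      intro e he
      obtain ⟨z, hz⟩ := h.weight_int e (Finset.mem_filter.1 he).1
      rw [hz]
      split_ifs
      · exact ⟨((s u * s (c u) : ℤˣ) : ℤ) * z, by push_cast; ring⟩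
      · exact ⟨z, one_mul _⟩
    choose! z hz using h1
    exact ⟨∑ e ∈ G.edges with reduceEdge (bond c u) v e = e', z e, by
      rw [Finset.sum_congr rfl hz]; push_cast; rfl⟩

end Elimination

/-! ### Correctness of RQAOA on signed cycles -/

section Recursion

theorem exists_max_abs_edge {V : Type*} [DecidableEq V] {E : Finset (Finset V)} {e₀ : Finset V}
    (he₀ : e₀ ∈ E) (hne : e₀.Nonempty) (M : Finset V → ℝ) :
    ∃ f ∈ E, f.Nonempty ∧ ∀ e ∈ E, e.Nonempty → |M e| ≤ |M f| := by
  obtain ⟨f, hf, hmax⟩ := Finset.exists_max_image (E.filter fun e => e.Nonempty)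
    (fun e => |M e|) ⟨e₀, Finset.mem_filter.2 ⟨he₀, hne⟩⟩
  rw [Finset.mem_filter] at hf
  exact ⟨f, hf.1, hf.2, fun e he he' => hmax e (Finset.mem_filter.2 ⟨he, he'⟩)⟩

/-- Level-`1` RQAOA can be run on a signed cycle, and it finds the ground state. -/
theorem IsSignedCycle.isRQAOARun (k : ℕ) : ∀ {V : Type} [Fintype V] [DecidableEq V]
    {G : WeightedHypergraph V} {c : Equiv.Perm V} {s : V → ℤˣ},
    IsSignedCycle G c s → k < Fintype.card V →
      (∃ x, IsRQAOARun 1 k G x) ∧ ∀ x, IsRQAOARun 1 k G x → ∃ ε : ℤˣ, ∀ v, x v = ε * s v := by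
  induction k with
  | zero =>
    intro V _ _ G c s h _
    refine ⟨?_, fun x hx => h.eq_or_neg_of_max hx⟩
    obtain ⟨x, hx⟩ := Finite.exists_max (energy G.hamiltonian)
    exact ⟨x, hx⟩
  | succ k ih =>
    intro V _ _ G c s h hk
    -- An elimination happens only with at least two vertices left, so there are no loops and a
    -- nonempty hyperedge is available.
    have hV : 1 < Fintype.card V := by omega
    have hcne := h.transitive.apply_ne hV
    have hcard : ∀ v : V, k < Fintype.card {w : V // w ≠ v} := fun v => by
      have : Fintype.card {w : V // w ≠ v} = Fintype.card V - 1 := Set.card_ne_eq v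
      omega
    constructor
    · obtain ⟨_, -, hd⟩ := h.exists_hamiltonian_eq_diagonal
      obtain ⟨β, γ, hopt⟩ := exists_isOptimalAngles 1 hd
      obtain ⟨v₀⟩ : Nonempty V := Fintype.card_pos_iff.1 (by omega)
      have hne₀ : (bond c v₀).Nonempty := ⟨v₀, mem_bond_left (hcne v₀)⟩
      obtain ⟨f, hf, hfne, hmax⟩ := exists_max_abs_edge ((h.mem_edges _ hne₀).2 ⟨v₀, rfl⟩) hne₀
        (fun e => expect (zProd e) (qaoaState G.hamiltonian β γ))
      obtain ⟨u, rfl⟩ := (h.mem_edges f hfne).1 hf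
      obtain ⟨v, hv⟩ := hfne
      obtain ⟨y, hy⟩ := (ih (h.eliminate (hcne v) hv) (hcard v)).1
      exact ⟨_, β, γ, hopt, _, hf, ⟨v, hv⟩, hmax, v, hv, _,
        (h.signUnit_expect_bond hV hopt u).symm, y, hy, rfl⟩
    · rintro x ⟨β, γ, hopt, f, hf, hfne, -, v, hv, σ, hσ, y, hy, rfl⟩
      obtain ⟨u, rfl⟩ := (h.mem_edges f hfne).1 hf
      rw [h.signUnit_expect_bond hV hopt u] at hσ
      subst hσ
      obtain ⟨ε, hε⟩ := (ih (h.eliminate (hcne v) hv) (hcard v)).2 y hy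
      exact ⟨ε, extend_eq hv hε⟩

variable {n : ℕ} [NeZero n]

theorem isSignedCycle_ringInstance (hn : 3 ≤ n) (x : ZMod n → ℤˣ) :
    IsSignedCycle (ringInstance (satisfiedCouplings x)) (Equiv.addRight 1) x := by
  have hne : ∀ v : ZMod n, v + 1 ≠ v := fun v h => by
    have : Fact (1 < n) := ⟨by omega⟩
    exact one_ne_zero (add_eq_left.1 h)
  have hb : ∀ v : ZMod n, bond (Equiv.addRight 1) v = {v, v + 1} := fun v =>
    bond_eq_pair (hne v)
  refine ⟨?_, ?_, ?_, ?_⟩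
  · rintro P hP ⟨u, hu⟩ w
    have h1 : ∀ i : ℕ, P (u + i) := by
      intro i
      induction i with
      | zero => simpa using hu
      | succ i ih =>
        have := hP _ ih
        simpa [add_assoc] using this
    have h2 := h1 (w - u).val
    rwa [ZMod.natCast_zmod_val, add_sub_cancel] at h2
  · intro e _
    simp only [ringInstance, Finset.mem_image, Finset.mem_univ, true_and, hb, eq_comm]
  · intro e _ _
    simp only [ringInstance, hb, satisfiedCouplings, eq_comm]
    rfl
  · intro e _
    refine ⟨∑ k : ZMod n, if e = {k, k + 1} then ((satisfiedCouplings x k : ℤˣ) : ℤ) else 0, ?_⟩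
    simp only [ringInstance]
    push_cast
    rfl

end Recursion

end QAOA

end
-- The main theorem
theorem theorem3 (n : ℕ) [NeZero n] (hn : 6 ∣ n) :
    ∃ S : Finset (ZMod n → ℤˣ), S.card = 2 ^ (n / 3) ∧
      (∃ A : ((QAOA.ringGraph n).edgeSet → ℝ) → ZMod n → ℤˣ,
        QAOA.IsUniformLocalAlgorithm (QAOA.ringGraph n) 0 (QAOA.ringTranslation n) 1 A ∧
        ∀ J ∈ S,
          QAOA.approxRatio (QAOA.ringHamiltonian J) (A (QAOA.ringWeights J)) = 1) ∧
      (∀ J ∈ S, ∀ p : ℕ, 2 * p < n →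
        ∃ ρ : ℝ, QAOA.IsQAOARatio p (QAOA.ringHamiltonian J) ρ ∧
          ρ ≤ (p : ℝ) / ((p : ℝ) + 1)) ∧
      (∀ J ∈ S, ∀ nc : ℕ, 1 ≤ nc → nc ≤ n →
        (∃ x : ZMod n → ℤˣ, QAOA.IsRQAOAOutput 1 nc (QAOA.ringInstance J) x) ∧
        ∀ x : ZMod n → ℤˣ, QAOA.IsRQAOAOutput 1 nc (QAOA.ringInstance J) x →
          QAOA.approxRatio (QAOA.ringHamiltonian J) x = 1) := by
  have h3 : 3 ∣ n := (by norm_num : 3 ∣ 6).trans hn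
  have hn6 : 6 ≤ n := Nat.le_of_dvd (NeZero.pos n) hn
  have hS : ∀ J ∈ QAOA.instanceFamily n, ∃ a : Fin (n / 3) → ℤˣ,
      J = QAOA.satisfiedCouplings (QAOA.sparseConfig a) := fun J hJ => by
    obtain ⟨a, -, ha⟩ := Finset.mem_image.1 hJ
    exact ⟨a, ha.symm⟩
  refine ⟨QAOA.instanceFamily n, QAOA.card_instanceFamily h3,
    ⟨QAOA.localRule (by omega), QAOA.isUniformLocalAlgorithm_localRule (by omega), ?_⟩, ?_, ?_⟩
  · intro J hJ
    obtain ⟨a, rfl⟩ := hS J hJ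
    rw [QAOA.localRule_eq_sparseConfig h3 (by omega)]
    exact QAOA.approxRatio_of_satisfied fun k => rfl
  · intro J hJ p hp
    obtain ⟨a, rfl⟩ := hS J hJ
    -- As `n` is even, `2 * p < n` gives `2 * p + 2 ≤ n`, the room needed for the light cone.
    exact QAOA.exists_isQAOARatio_le (by omega) (x := QAOA.sparseConfig a) fun k => rfl
  · intro J hJ nc h1 h2
    obtain ⟨a, rfl⟩ := hS J hJ
    have hrun := (QAOA.isSignedCycle_ringInstance (by omega) (QAOA.sparseConfig a)).isRQAOARun
      (Fintype.card (ZMod n) - nc) (by rw [ZMod.card]; omega)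
    refine ⟨hrun.1, fun x hx => ?_⟩
    obtain ⟨ε, hε⟩ := hrun.2 x hx
    -- The global sign `ε` cancels in every product of two spins.
    refine QAOA.approxRatio_of_satisfied fun k => ?_
    rw [hε, hε, mul_mul_mul_comm, Int.units_mul_self, one_mul]
    rfl
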